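/- **Setting.** Let $n_x,n_w,n_\theta,N$ be positive integers, $n_z=2n_x+n_w$, $C\in\mathbb R^{n_y\times n_x}$, $\Pi:\mathbb R^{4n_x+n_w}\to\mathbb R^{n_\Pi}$, $\delta>0$, $\kappa\in(0,\infty)$, and let $\phi_i:\mathbb R^{n_x}\times\mathbb R^{n_w}\to\mathbb R^{n_x}$, $\psi_i:\mathbb R^{n_x}\to\mathbb R^{n_x}$ ($1\le i\le n_\theta$) be real analytic. For $\theta\in\mathbb R^{n_\theta}$ put $e_\theta=\sum_i\theta_i\psi_i$, $f_\theta=\sum_i\theta_i\phi_i$, $a_\theta=e_\theta^{-1}\circ f_\theta$ (when $e_\theta$ is bijective). Write $[\xi;x;w]$ for stacked vectors, $|v|_P^2=v'Pv$, and $z^\alpha=\prod_d z_d^{\alpha_d}$ for $\alpha\in\mathbb Z_+^{n_z}$. *The set $\mathbf\Theta(N,\delta,\Pi)$* consists of the pairs $(\theta,r)$, with $\theta\in\mathbb R^{n_\theta}$ and $r$ a real polynomial in $n_z$ variables of degree at most $N$, for which there are symmetric $P\ge\delta I$, $\Sigma_1\ge0$, $\Sigma_2\ge0$ and $\epsilon>0$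 such that, for all $\xi,x,\Delta,q\in\mathbb R^{n_x}$, $w\in\mathbb R^{n_w}$, with $z=[\xi;x;w]$ and $v=[\xi;x;w;\Delta;q]$, $$r(z)+2\Delta'[e_\theta(x+\Delta)-e_\theta(x)]-|\Delta|^2_{P+C'C}+|q|_P^2-2q'(f_\theta(x+\Delta,w)-e_\theta(\xi))=\Pi(v)'\Sigma_1\Pi(v),$$ $$2\Delta'[e_\theta(x+\Delta)-e_\theta(x)]-|\Delta|^2_{P+\epsilon I}+|q|_P^2-2q'(f_\theta(x+\Delta,w)-f_\theta(x,w))=\Pi(v)'\Sigma_2\Pi(v)$$ (this forces $e_\theta$ to be a bijection). *The algorithm $\mathcal A(\delta,\Pi,\kappa)$.* A data set $\Xi=(\tilde w,\tilde x_1,\dots,\tilde x_N)$ of length $T$ consists of sequences indexed by $\{0,\dots,T\}$; put $\tilde z_i(t)=[\tilde x_i(t);\tilde x_i(t-1);\tilde w(t)]$. For $\|\alpha\|_1\le N$ let $\tilde\mu_\alpha(\Xi)=\frac1T\sum_{t=1}^T\prod_{i=1}^{\|\alpha\|_1}[\tilde z_i(t)]_{\beta(i)}$, where $\beta(i)=\min\{d\in\{1,\dots,n_z\}:\alpha_1+\dots+\alpha_d\ge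 i\}$. Let $\aleph=\{\alpha:2\|\alpha\|_1\le N\}$, $\tilde M_\Xi=(\tilde\mu_{\alpha+\beta}(\Xi))_{\alpha,\beta\in\aleph}$, and let $\hat M_\Xi$ be the Frobenius-norm projection of $\frac12(\tilde M_\Xi+\tilde M_\Xi')$ onto the positive semidefinite cone. Call $(\theta,r,R)$ *feasible* if $(\theta,r)\in\mathbf\Theta(N,\delta,\Pi)$, $R=R'\in\mathbb R^{\aleph\times\aleph}$, $r(z)=\sum_{\alpha,\beta\in\aleph}R_{\alpha\beta}z^{\alpha+\beta}$ and $\|R\|_F^2\le\kappa$. The algorithm returns the $\theta$ of a feasible $(\theta,r,R)$ that minimizes $\mathrm{tr}(R\hat M_\Xi)$ over all feasible triples. *Systems.* A function $a:\mathbb R^{n_x}\times\mathbb R^{n_w}\to\mathbb R^{n_x}$ defines the system $x(t)=a(x(t-1),w(t))$. It is BIBO if every response to a bounded input is bounded, and incrementally exponentially stable if there are $c>0$, $\rho\in(0,1)$ with $|x(t)-\hat x(t)|\le c\rho^t|x(0)-\hat x(0)|$ for all $t\ge 0$ and all responses $x,\hat x$ to the same input, whatever the input. A pair of signals $(w,x)$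 is *persistently exciting for $a$* if there is a positive measure $\pi$ on $\mathbb R^{n_x}\times\mathbb R^{n_w}$ whose support contains a nonempty open set, with $\int|[a(x,w);x;w]^\alpha|\,d\pi<\infty$ for all $\alpha$, such that for every finite $A\subset\mathbb Z_+^{n_z}$ $$\liminf_{T\to\infty}\lambda_{\min}\Big(\tfrac1T\sum_{t=1}^T[x(t);x(t-1);w(t)]^{\alpha+\beta}-\int[a(x,w);x;w]^{\alpha+\beta}d\pi(x,w)\Big)_{\alpha,\beta\in A}\ge0.$$ **Theorem.** Let the data be $\tilde w:\mathbb Z_+\to\mathbb R^{n_w}$ and $\tilde x_i=\bar x_i+v_i:\mathbb Z_+\to\mathbb R^{n_x}$ ($1\le i\le N$), stochastic processes such that: - (A1) $\tilde w$ is uniformly bounded; - (A2) the processes $v_i$ are bounded, zero mean, i.i.d. in time, independent of one another and of $(\tilde w,\bar x_1,\dots,\bar x_N)$; - (A4) there is a BIBO and incrementally exponentially stable $a_0$ such that each $\bar x_i$ is the response of $a_0$ to $\tilde w$ from some bounded (possibly random) initial state, and with probability one all the pairs $(\tilde w,\bar x_i)$ are persistently exciting for $a_0$. Suppose that $a_0$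 is in the recoverable set, through a point that the algorithm admits: there is a feasible $(\theta,r,R)$ with $a_0=a_\theta$ and $r([a_0(x,w);x;w])=0$ for all $(x,w)$. Let $\Xi_T$ be the restriction of the data to $\{0,\dots,T\}$, and let $\theta_T$ be a parameter vector found by $\mathcal A(\delta,\Pi,\kappa)$ on $\Xi_T$ (it is enough that this holds with probability tending to $1$ as $T\to\infty$). Then for every compact $K\subset\mathbb R^{n_x}\times\mathbb R^{n_w}$ $$\sup_{(x,w)\in K}\big|e_{\theta_T}^{-1}(f_{\theta_T}(x,w))-a_0(x,w)\big|\to0\quad\text{in probability as }T\to\infty .$$ -/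

import Mathlib

open MeasureTheory ProbabilityTheory Filter Topology Matrix

namespace SysId

noncomputable section

/-- The Euclidean space `ℝⁿ`. -/
abbrev Vec (n : ℕ) : Type := EuclideanSpace ℝ (Fin n)

/-! ### State space models -/

/-- The response `x = G_a(x₀, w)` of the system `x(t) = a(x(t-1), w(t))`, `x(0) = x₀`. -/
def response {nx nw : ℕ} (a : Vec nx × Vec nw → Vec nx) (x₀ : Vec nx) (w : ℕ → Vec nw) :
    ℕ → Vec nx
  | 0 => x₀
  | t + 1 => a (response a x₀ w t, w (t + 1))

/-- Bounded inputs produce bounded responses, from every initial state. -/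
def IsBIBO {nx nw : ℕ} (a : Vec nx × Vec nw → Vec nx) : Prop :=
  ∀ (x₀ : Vec nx) (w : ℕ → Vec nw), (∃ b : ℝ, ∀ t, ‖w t‖ ≤ b) →
    ∃ B : ℝ, ∀ t, ‖response a x₀ w t‖ ≤ B

/-- Incremental exponential stability. -/
def IsIncrExpStable {nx nw : ℕ} (a : Vec nx × Vec nw → Vec nx) : Prop :=
  ∃ c ρ : ℝ, 0 < c ∧ 0 < ρ ∧ ρ < 1 ∧
    ∀ (x₀ x₀' : Vec nx) (w : ℕ → Vec nw) (t : ℕ),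
      ‖response a x₀ w t - response a x₀' w t‖ ≤ c * ρ ^ t * ‖x₀ - x₀'‖

/-- `e_θ(ξ) = ∑ θ_i ψ_i(ξ)`. -/
def eMap {nx nθ : ℕ} (ψ : Fin nθ → Vec nx → Vec nx) (θ : Fin nθ → ℝ) (ξ : Vec nx) : Vec nx :=
  ∑ i, θ i • ψ i ξ

/-- `f_θ(x, w) = ∑ θ_i φ_i(x, w)`. -/
def fMap {nx nw nθ : ℕ} (φ : Fin nθ → Vec nx × Vec nw → Vec nx) (θ : Fin nθ → ℝ)
    (p : Vec nx × Vec nw) : Vec nx :=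
  ∑ i, θ i • φ i p

/-- `a_θ = e_θ⁻¹ ∘ f_θ`. For every parameter admitted below, `e_θ` is a bijection, so that
`Function.invFun` is its inverse. -/
def implicitModel {nx nw nθ : ℕ} (φ : Fin nθ → Vec nx × Vec nw → Vec nx)
    (ψ : Fin nθ → Vec nx → Vec nx) (θ : Fin nθ → ℝ) (p : Vec nx × Vec nw) : Vec nx :=
  Function.invFun (eMap ψ θ) (fMap φ θ p)

/-! ### Stacked vectors, monomials, empirical moments -/

/-- The stacked vector `z = [ξ; x; w]`. -/
def stack {nx nw : ℕ} (ξ x : Vec nx) (w : Vec nw) : Fin (nx + nx + nw) → ℝ :=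
  Fin.append (Fin.append ξ.ofLp x.ofLp) w.ofLp

/-- The stacked vector `v = [ξ; x; w; Δ; q]`. -/
def stackExt {nx nw : ℕ} (ξ x : Vec nx) (w : Vec nw) (Δ q : Vec nx) :
    Fin (nx + nx + nw + nx + nx) → ℝ :=
  Fin.append (Fin.append (stack ξ x w) Δ.ofLp) q.ofLp

/-- The monomial `z^α`. -/
def monom {nz : ℕ} (α : Fin nz → ℕ) (z : Fin nz → ℝ) : ℝ := ∏ d, z d ^ α d

/-- A data set with `N` experiments of length `T`. -/
structure DataSet (nx nw N T : ℕ) where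
  /-- the common input -/
  w : Fin (T + 1) → Vec nw
  /-- the measured states of the experiments -/
  x : Fin N → Fin (T + 1) → Vec nx

/-- The restriction of infinite signals to `{0, …, T}`. -/
def DataSet.restrict {nx nw N : ℕ} (w : ℕ → Vec nw) (x : Fin N → ℕ → Vec nx) (T : ℕ) :
    DataSet nx nw N T where
  w t := w t
  x i t := x i t

/-- `z_i(t + 1) = [x_i(t + 1); x_i(t); w(t + 1)]` for `t ∈ {0, …, T - 1}`. -/
def DataSet.z {nx nw N T : ℕ} (Ξ : DataSet nx nw N T) (i : Fin N) (t : Fin T) :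
    Fin (nx + nx + nw) → ℝ :=
  stack (Ξ.x i t.succ) (Ξ.x i t.castSucc) (Ξ.w t.succ)

/-- The multilinear function `p_α(z_1, …, z_N) = ∏_{i = 1}^{‖α‖₁} [z_i]_{β(i)}`, where `β(i)` is the
least `d` with `α_1 + ⋯ + α_d ≥ i`. The index `i` starts at `0` here, and such a `d` exists exactly
when `i < ‖α‖₁`. -/
def pFun {nz N : ℕ} (α : Fin nz → ℕ) (z : Fin N → Fin nz → ℝ) : ℝ :=
  ∏ i : Fin N, if h : ∃ d : Fin nz, (i : ℕ) < ∑ j ∈ Finset.Iic d, α j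
    then z i (Fin.find (fun d : Fin nz => (i : ℕ) < ∑ j ∈ Finset.Iic d, α j) h) else 1

/-- The linearized empirical moment `μ̃_α(Ξ)`. -/
def linMoment {nx nw N T : ℕ} (Ξ : DataSet nx nw N T) (α : Fin (nx + nx + nw) → ℕ) : ℝ :=
  (1 / (T : ℝ)) * ∑ t : Fin T, pFun α (fun i => Ξ.z i t)

/-- The empirical moment `μ_α` of a pair of signals, restricted to `{0, …, T}`. -/
def empMoment {nx nw : ℕ} (w : ℕ → Vec nw) (x : ℕ → Vec nx) (T : ℕ)
    (α : Fin (nx + nx + nw) → ℕ) : ℝ :=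
  (1 / (T : ℝ)) * ∑ t ∈ Finset.range T, monom α (stack (x (t + 1)) (x t) (w (t + 1)))

/-! ### Persistence of excitation -/

/-- The least eigenvalue of a symmetric matrix. -/
def lambdaMin {ι : Type*} [Fintype ι] [DecidableEq ι] (M : Matrix ι ι ℝ) : ℝ :=
  sInf (spectrum ℝ M)

/-- The pair `(w, x)` is persistently exciting for `a`: there is a positive measure `π`, with all
moments below finite and with a nonempty open set in its support, such that
`liminf_T λ_min (M_T - M_π) ≥ 0` for every finite set `A` of multi-indices. -/
def PersistentlyExciting {nx nw : ℕ} (a : Vec nx × Vec nw → Vec nx) (w : ℕ → Vec nw)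
    (x : ℕ → Vec nx) : Prop :=
  ∃ π : Measure (Vec nx × Vec nw),
    (∃ U : Set (Vec nx × Vec nw), IsOpen U ∧ U.Nonempty ∧ U ⊆ π.support) ∧
    (∀ α : Fin (nx + nx + nw) → ℕ,
      Integrable (fun p : Vec nx × Vec nw => monom α (stack (a p) p.1 p.2)) π) ∧
    ∀ A : Finset (Fin (nx + nx + nw) → ℕ),
      (0 : EReal) ≤ liminf (fun T : ℕ => ((lambdaMin (Matrix.of fun α β : A =>
        empMoment w x T (α.1 + β.1) -
          ∫ p : Vec nx × Vec nw, monom (α.1 + β.1) (stack (a p) p.1 p.2) ∂π) : ℝ) : EReal)) atTop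

/-! ### The convex parameterization -/

/-- The pairs `(θ, r)` in `Θ(N, δ, Π)`. -/
def InTheta {nx nw ny nθ nPi : ℕ} (φ : Fin nθ → Vec nx × Vec nw → Vec nx)
    (ψ : Fin nθ → Vec nx → Vec nx) (C : Matrix (Fin ny) (Fin nx) ℝ) (N : ℕ) (δ : ℝ)
    (Pi : (Fin (nx + nx + nw + nx + nx) → ℝ) → Fin nPi → ℝ)
    (θ : Fin nθ → ℝ) (r : MvPolynomial (Fin (nx + nx + nw)) ℝ) : Prop :=
  r.totalDegree ≤ N ∧
  ∃ (P : Matrix (Fin nx) (Fin nx) ℝ) (S₁ S₂ : Matrix (Fin nPi) (Fin nPi) ℝ) (ε : ℝ),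
    P.IsSymm ∧ (P - δ • (1 : Matrix (Fin nx) (Fin nx) ℝ)).PosSemidef ∧
    S₁.PosSemidef ∧ S₂.PosSemidef ∧ 0 < ε ∧
    (∀ (ξ x : Vec nx) (w : Vec nw) (Δ q : Vec nx),
      MvPolynomial.eval (stack ξ x w) r
        + 2 * inner ℝ Δ (eMap ψ θ (x + Δ) - eMap ψ θ x)
        - Δ.ofLp ⬝ᵥ (P + Cᵀ * C) *ᵥ Δ.ofLp + q.ofLp ⬝ᵥ P *ᵥ q.ofLp
        - 2 * inner ℝ q (fMap φ θ (x + Δ, w) - eMap ψ θ ξ)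
      = Pi (stackExt ξ x w Δ q) ⬝ᵥ S₁ *ᵥ Pi (stackExt ξ x w Δ q)) ∧
    (∀ (ξ x : Vec nx) (w : Vec nw) (Δ q : Vec nx),
      2 * inner ℝ Δ (eMap ψ θ (x + Δ) - eMap ψ θ x)
        - Δ.ofLp ⬝ᵥ (P + ε • (1 : Matrix (Fin nx) (Fin nx) ℝ)) *ᵥ Δ.ofLp
        + q.ofLp ⬝ᵥ P *ᵥ q.ofLp
        - 2 * inner ℝ q (fMap φ θ (x + Δ, w) - fMap φ θ (x, w))
      = Pi (stackExt ξ x w Δ q) ⬝ᵥ S₂ *ᵥ Pi (stackExt ξ x w Δ q))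

/-! ### The identification algorithm -/

/-- The set `ℵ` of the multi-indices `α` with `2 ‖α‖₁ ≤ N`. -/
def aleph (nz N : ℕ) : Finset (Fin nz → ℕ) :=
  (Fintype.piFinset fun _ : Fin nz => Finset.range (N + 1)).filter fun α => 2 * ∑ d, α d ≤ N

theorem mem_aleph {nz N : ℕ} {α : Fin nz → ℕ} : α ∈ aleph nz N ↔ 2 * ∑ d, α d ≤ N := by
  simp only [aleph, Finset.mem_filter, Fintype.mem_piFinset, Finset.mem_range,
    and_iff_right_iff_imp]
  intro h d
  have := Finset.single_le_sum (f := α) (fun _ _ => Nat.zero_le _) (Finset.mem_univ d)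
  omega

/-- The squared Frobenius norm. -/
def frobSq {ι : Type*} [Fintype ι] (M : Matrix ι ι ℝ) : ℝ := ∑ i, ∑ j, M i j ^ 2

/-- `Q` is the (Frobenius) projection of `S` onto the cone of positive semidefinite matrices. -/
def IsPSDProjection {ι : Type*} [Fintype ι] (S Q : Matrix ι ι ℝ) : Prop :=
  Q.PosSemidef ∧ ∀ Q' : Matrix ι ι ℝ, Q'.PosSemidef → frobSq (S - Q) ≤ frobSq (S - Q')

/-- The matrix `M̃_Ξ` of linearized empirical moments. -/
def momentMatrix {nx nw N T : ℕ} (Ξ : DataSet nx nw N T) :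
    Matrix (aleph (nx + nx + nw) N) (aleph (nx + nx + nw) N) ℝ :=
  Matrix.of fun α β => linMoment Ξ (α.1 + β.1)

/-- Feasibility of `(θ, r, R)` in the optimization problem of the algorithm `𝒜(δ, Π, κ)`. -/
def IsFeasible {nx nw ny nθ nPi : ℕ} (φ : Fin nθ → Vec nx × Vec nw → Vec nx)
    (ψ : Fin nθ → Vec nx → Vec nx) (C : Matrix (Fin ny) (Fin nx) ℝ) (N : ℕ) (δ : ℝ)
    (Pi : (Fin (nx + nx + nw + nx + nx) → ℝ) → Fin nPi → ℝ) (κ : ℝ)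
    (θ : Fin nθ → ℝ) (r : MvPolynomial (Fin (nx + nx + nw)) ℝ)
    (R : Matrix (aleph (nx + nx + nw) N) (aleph (nx + nx + nw) N) ℝ) : Prop :=
  InTheta φ ψ C N δ Pi θ r ∧ R.IsSymm ∧
  (∀ z : Fin (nx + nx + nw) → ℝ,
    MvPolynomial.eval z r = ∑ α, ∑ β, R α β * monom (α.1 + β.1) z) ∧
  frobSq R ≤ κ

/-- `θ` is a parameter vector found by the algorithm `𝒜(δ, Π, κ)` on the data set `Ξ`: it is part of
an optimal `(θ, r, R)`. -/
def IsAlgorithmOutput {nx nw ny nθ nPi N T : ℕ} (φ : Fin nθ → Vec nx × Vec nw → Vec nx)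
    (ψ : Fin nθ → Vec nx → Vec nx) (C : Matrix (Fin ny) (Fin nx) ℝ) (δ : ℝ)
    (Pi : (Fin (nx + nx + nw + nx + nx) → ℝ) → Fin nPi → ℝ) (κ : ℝ)
    (Ξ : DataSet nx nw N T) (θ : Fin nθ → ℝ) : Prop :=
  ∃ (Mhat : Matrix (aleph (nx + nx + nw) N) (aleph (nx + nx + nw) N) ℝ)
    (r : MvPolynomial (Fin (nx + nx + nw)) ℝ)
    (R : Matrix (aleph (nx + nx + nw) N) (aleph (nx + nx + nw) N) ℝ),
    IsPSDProjection ((1 / 2 : ℝ) • (momentMatrix Ξ + (momentMatrix Ξ)ᵀ)) Mhat ∧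
    IsFeasible φ ψ C N δ Pi κ θ r R ∧
    ∀ θ' r' R', IsFeasible φ ψ C N δ Pi κ θ' r' R' → (R * Mhat).trace ≤ (R' * Mhat).trace

/-- The functions `a` recovered by a feasible point: `a = a_θ` and `r([a(x, w); x; w]) = 0` for some
`(θ, r) ∈ Θ(N, δ, Π)` whose `r` has a Gram matrix `R` obeying the bound `‖R‖_F² ≤ κ`. -/
def recoverableSet {nx nw ny nθ nPi : ℕ} (φ : Fin nθ → Vec nx × Vec nw → Vec nx)
    (ψ : Fin nθ → Vec nx → Vec nx) (C : Matrix (Fin ny) (Fin nx) ℝ) (N : ℕ) (δ : ℝ)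
    (Pi : (Fin (nx + nx + nw + nx + nx) → ℝ) → Fin nPi → ℝ) (κ : ℝ) :
    Set (Vec nx × Vec nw → Vec nx) :=
  {a | ∃ θ r R, IsFeasible φ ψ C N δ Pi κ θ r R ∧ (∀ p, a p = implicitModel φ ψ θ p) ∧
    ∀ p, MvPolynomial.eval (stack (a p) p.1 p.2) r = 0}

/-! ### The data generation mechanism -/

/-- The input is a uniformly bounded stochastic process. -/
def BoundedInput {Ω : Type*} [MeasurableSpace Ω] {nw : ℕ} (μ : Measure Ω)
    (w : ℕ → Ω → Vec nw) : Prop :=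
  (∀ t, Measurable (w t)) ∧ ∃ b : ℝ, ∀ t, ∀ᵐ ω ∂μ, ‖w t ω‖ ≤ b

/-- The noises `v_i` are bounded, zero mean, i.i.d. in time, independent of one another, and
(jointly) independent of the input and the true states. -/
def NoiseConditions {Ω : Type*} [MeasurableSpace Ω] {nx nw N : ℕ} (μ : Measure Ω)
    (w : ℕ → Ω → Vec nw) (xbar v : Fin N → ℕ → Ω → Vec nx) : Prop :=
  (∀ i t, Measurable (xbar i t)) ∧
  (∀ i t, Measurable (v i t)) ∧
  (∃ b : ℝ, ∀ i t, ∀ᵐ ω ∂μ, ‖v i t ω‖ ≤ b) ∧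
  (∀ i t, ∫ ω, v i t ω ∂μ = 0) ∧
  (∀ i s t, IdentDistrib (v i s) (v i t) μ μ) ∧
  iIndepFun (fun (p : Fin N × ℕ) ω => v p.1 p.2 ω) μ ∧
  IndepFun (fun ω (p : Fin N × ℕ) => v p.1 p.2 ω)
    (fun ω => ((fun t => w t ω), (fun p : Fin N × ℕ => xbar p.1 p.2 ω))) μ

/-- The true states are responses, from bounded initial states, of the BIBO and incrementally
exponentially stable system `a₀` to the input, and almost surely the pairs `(w, xbar_i)` are
persistently exciting for `a₀`. -/
def SystemConditions {Ω : Type*} [MeasurableSpace Ω] {nx nw N : ℕ} (μ : Measure Ω)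
    (a₀ : Vec nx × Vec nw → Vec nx) (w : ℕ → Ω → Vec nw) (xbar : Fin N → ℕ → Ω → Vec nx) : Prop :=
  IsBIBO a₀ ∧ IsIncrExpStable a₀ ∧
  (∃ x₀ : Fin N → Ω → Vec nx, (∃ b : ℝ, ∀ i ω, ‖x₀ i ω‖ ≤ b) ∧
    ∀ᵐ ω ∂μ, ∀ i t, xbar i t ω = response a₀ (x₀ i ω) (fun s => w s ω) t) ∧
  ∀ᵐ ω ∂μ, ∀ i, PersistentlyExciting a₀ (fun t => w t ω) (fun t => xbar i t ω)

end

end SysId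

open SysId

/-!
Every feasible `r` dominates the one-step prediction error of its model:
`(δ / 4) |a_θ(x, w) - ξ|² ≤ r([ξ; x; w])` (`InTheta.sq_error_le`), with a constant free of `θ`. So it
suffices that the polynomials `r` found by the algorithm become small on the graph of `a₀`,
uniformly over compact sets; the parameters themselves need not converge, nor stay bounded.

*The cost is small on noise-free data.* Each experiment enters `p_α` through one factor only, hence
conditionally on the input and the true states the linearized moments of the noisy data have those
of the true states as their mean, and their variance is `O(1 / T)` because terms at different times
are independent (`exists_measure_linMoment_le`). By incremental stability all experiments approach a
single trajectory, so that the data matrix is close to the true moment matrix `E` of that trajectory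
(`tendsto_measure_frobSq`). As `E` is positive semidefinite, the projected data matrix is close to
`E` as well. Comparison with the feasible point of `a₀`, whose cost for `E` is zero, shows that
`tr(R E)`, the time average of `r` along the true trajectory, tends to zero in probability for the
optimal `R` (`IsAlgorithmOutput.exists_trace_le`).

*Small cost forces a small error.* The admissible `R` form a bounded set, so that a sequence of them
has a limit point, the Gram matrix of a polynomial which is nonnegative and whose time averages tend
to zero. It may fail to be a sum of squares of polynomials, but on bounded sets its square root is a
uniform limit of polynomials, and the excitation condition for squares of polynomials of all degrees
shows that it vanishes on the graph of `a₀` over an open set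
(`PersistentlyExciting.exists_isOpen_eval_eq_zero`). Since `e_θ` is strongly monotone, it is a
bijection with analytic inverse, hence `a₀` is analytic, and the polynomial vanishes on the whole
graph (`PersistentlyExciting.exists_cost_threshold`).

*Measurability.* The threshold so obtained depends on the realization of the input and of the true
states, and nothing is assumed measurable about the parameter estimates. The bad event is enlarged to
an event of the form `(V, W) ∈ S` with `S` open, `V` the noise and `W` the signals, and
`tendsto_measure_of_indepFun` reduces the claim to a frozen realization of `W`.
-/

namespace SysId

/-! ### Strongly monotone maps -/

section StronglyMonotone

variable {E : Type*} [NormedAddCommGroup E] [InnerProductSpace ℝ E] {e : E → E} {m : ℝ}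

theorem norm_le_of_stronglyMonotone
    (he : ∀ x Δ : E, m * ‖Δ‖ ^ 2 ≤ inner ℝ Δ (e (x + Δ) - e x)) (x y : E) :
    m * ‖y - x‖ ≤ ‖e y - e x‖ := by
  have h := he x (y - x)
  rw [add_sub_cancel] at h
  have h2 := h.trans (real_inner_le_norm _ _)
  rcases (norm_nonneg (y - x)).eq_or_lt with h0 | h0
  · rw [← h0, mul_zero]
    exact norm_nonneg _
  · nlinarith

theorem injective_of_stronglyMonotone (hm : 0 < m)
    (he : ∀ x Δ : E, m * ‖Δ‖ ^ 2 ≤ inner ℝ Δ (e (x + Δ) - e x)) : Function.Injective e := by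
  intro x y hxy
  have h := norm_le_of_stronglyMonotone he x y
  rw [hxy, sub_self, norm_zero] at h
  have : ‖y - x‖ ≤ 0 := by nlinarith [norm_nonneg (y - x)]
  exact (sub_eq_zero.1 (norm_le_zero_iff.1 this)).symm

/-- The derivative of a strongly monotone map inherits the monotonicity bound, hence is injective,
hence invertible in finite dimension. -/
theorem exists_equiv_fderiv_of_stronglyMonotone [FiniteDimensional ℝ E] (hm : 0 < m)
    (he : ∀ x Δ : E, m * ‖Δ‖ ^ 2 ≤ inner ℝ Δ (e (x + Δ) - e x)) (x : E)
    (hd : DifferentiableAt ℝ e x) : ∃ L : E ≃L[ℝ] E, (L : E →L[ℝ] E) = fderiv ℝ e x := by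
  have key : ∀ v : E, m * ‖v‖ ^ 2 ≤ inner ℝ v (fderiv ℝ e x v) := by
    intro v
    have h1 := (hd.hasFDerivAt.hasLineDerivAt v).tendsto_slope_zero_right
    have h2 : Tendsto (fun t : ℝ => inner ℝ v (t⁻¹ • (e (x + t • v) - e x))) (𝓝[>] 0)
        (𝓝 (inner ℝ v (fderiv ℝ e x v))) :=
      (tendsto_const_nhds (x := v)).inner (by simpa using h1)
    refine ge_of_tendsto h2 ?_
    filter_upwards [self_mem_nhdsWithin] with t ht
    have ht : 0 < t := ht
    have h3 := he x (t • v)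
    rw [norm_smul, Real.norm_of_nonneg ht.le, real_inner_smul_left] at h3
    rw [real_inner_smul_right]
    have h4 : t * (m * ‖v‖ ^ 2) ≤ t * (t⁻¹ * inner ℝ v (e (x + t • v) - e x)) := by
      rw [mul_inv_cancel_left₀ ht.ne']
      nlinarith
    exact le_of_mul_le_mul_left h4 ht
  have hinj : Function.Injective (fderiv ℝ e x : E →ₗ[ℝ] E) := by
    rw [injective_iff_map_eq_zero]
    intro v hv
    have h := key v
    rw [show fderiv ℝ e x v = 0 from hv, inner_zero_right] at h
    have : ‖v‖ ^ 2 ≤ 0 := by nlinarith [sq_nonneg ‖v‖]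
    exact norm_eq_zero.1 (pow_eq_zero_iff two_ne_zero |>.1 (le_antisymm this (sq_nonneg _)))
  refine ⟨(LinearEquiv.ofInjectiveEndo _ hinj).toContinuousLinearEquiv, ?_⟩
  ext v
  rfl

variable [FiniteDimensional ℝ E]

/-- The range is open by the inverse function theorem, and closed because the map expands
distances. -/
theorem surjective_of_stronglyMonotone (hm : 0 < m)
    (he : ∀ x Δ : E, m * ‖Δ‖ ^ 2 ≤ inner ℝ Δ (e (x + Δ) - e x))
    (ha : AnalyticOnNhd ℝ e Set.univ) : Function.Surjective e := by
  have : CompleteSpace E := FiniteDimensional.complete ℝ E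
  choose L hL using fun x => exists_equiv_fderiv_of_stronglyMonotone hm he x
    (ha x trivial).differentiableAt
  have hstrict : ∀ x, HasStrictFDerivAt e (L x : E →L[ℝ] E) x := fun x => by
    rw [hL]
    exact (ha x trivial).hasStrictFDerivAt
  have hopen : IsOpen (Set.range e) :=
    (isOpenMap_of_hasStrictFDerivAt_equiv hstrict).isOpen_range
  have hanti : AntilipschitzWith (Real.toNNReal m⁻¹) e := by
    refine AntilipschitzWith.of_le_mul_dist fun x y => ?_
    rw [Real.coe_toNNReal _ (inv_pos.2 hm).le, dist_eq_norm, dist_eq_norm, inv_mul_eq_div,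
      le_div_iff₀ hm, mul_comm]
    exact norm_le_of_stronglyMonotone he y x
  have hclosed : IsClosed (Set.range e) := by
    refine isClosed_of_closure_subset fun y hy => ?_
    obtain ⟨u, hu, hlim⟩ := mem_closure_iff_seq_limit.1 hy
    choose x hx using hu
    have hc : CauchySeq x := by
      have h1 : CauchySeq (e ∘ x) := by
        rw [show e ∘ x = u from funext hx]
        exact hlim.cauchySeq
      rw [Metric.cauchySeq_iff'] at h1 ⊢
      intro ε hε
      obtain ⟨n, hn⟩ := h1 (m * ε) (by positivity)
      refine ⟨n, fun k hk => ?_⟩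
      have h2 := hn k hk
      rw [dist_eq_norm] at h2 ⊢
      have h3 := norm_le_of_stronglyMonotone he (x n) (x k)
      exact lt_of_mul_lt_mul_left (h3.trans_lt h2) hm.le
    obtain ⟨a, ha'⟩ := cauchySeq_tendsto_of_complete hc
    have h4 : Tendsto (fun n => e (x n)) atTop (𝓝 (e a)) :=
      ((ha a trivial).continuousAt.tendsto).comp ha'
    simp only [hx] at h4
    exact ⟨a, tendsto_nhds_unique h4 hlim⟩
  exact Set.range_eq_univ.1 (IsClopen.eq_univ ⟨hclosed, hopen⟩ (Set.range_nonempty e))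

theorem analyticAt_invFun_of_stronglyMonotone (hm : 0 < m)
    (he : ∀ x Δ : E, m * ‖Δ‖ ^ 2 ≤ inner ℝ Δ (e (x + Δ) - e x))
    (ha : AnalyticOnNhd ℝ e Set.univ) (y : E) : AnalyticAt ℝ (Function.invFun e) y := by
  have : CompleteSpace E := FiniteDimensional.complete ℝ E
  obtain ⟨x, rfl⟩ := surjective_of_stronglyMonotone hm he ha y
  obtain ⟨L, hL⟩ := exists_equiv_fderiv_of_stronglyMonotone hm he x
    (ha x trivial).differentiableAt
  have hs : HasStrictFDerivAt e (L : E →L[ℝ] E) x := by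
    rw [hL]
    exact (ha x trivial).hasStrictFDerivAt
  have h1 : AnalyticAt ℝ (hs.toOpenPartialHomeomorph e).symm (e x) :=
    (hs.toOpenPartialHomeomorph e).analyticAt_symm' hs.mem_toOpenPartialHomeomorph_source
      (ha x trivial) hL.symm
  refine h1.congr ?_
  filter_upwards [(hs.toOpenPartialHomeomorph e).open_target.mem_nhds
    hs.image_mem_toOpenPartialHomeomorph_target] with z hz
  apply injective_of_stronglyMonotone hm he
  rw [Function.rightInverse_invFun (surjective_of_stronglyMonotone hm he ha)]
  exact (hs.toOpenPartialHomeomorph e).right_inv hz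

end StronglyMonotone

/-! ### The implicit models -/

section Model

variable {nx nw ny nθ nPi N : ℕ} {φ : Fin nθ → Vec nx × Vec nw → Vec nx}
  {ψ : Fin nθ → Vec nx → Vec nx} {C : Matrix (Fin ny) (Fin nx) ℝ} {δ : ℝ}
  {Pi : (Fin (nx + nx + nw + nx + nx) → ℝ) → Fin nPi → ℝ} {θ : Fin nθ → ℝ}
  {r : MvPolynomial (Fin (nx + nx + nw)) ℝ}

theorem analyticOnNhd_eMap (hψ : ∀ i, AnalyticOnNhd ℝ (ψ i) Set.univ) (θ : Fin nθ → ℝ) :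
    AnalyticOnNhd ℝ (eMap ψ θ) Set.univ := by
  intro x hx
  unfold eMap
  exact Finset.analyticAt_fun_sum _ fun i _ => analyticAt_const.fun_smul (hψ i x hx)

theorem analyticOnNhd_fMap (hφ : ∀ i, AnalyticOnNhd ℝ (φ i) Set.univ) (θ : Fin nθ → ℝ) :
    AnalyticOnNhd ℝ (fMap φ θ) Set.univ := by
  intro x hx
  unfold fMap
  exact Finset.analyticAt_fun_sum _ fun i _ => analyticAt_const.fun_smul (hφ i x hx)

theorem dotProduct_self_eq_norm_sq (v : Vec nx) : v.ofLp ⬝ᵥ v.ofLp = ‖v‖ ^ 2 := by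
  rw [EuclideanSpace.real_norm_sq_eq, dotProduct]
  simp [sq]

/-- The metric `P` of a point of `Θ(N, δ, Π)`: it dominates `δ I`, the map `e_θ` is strongly monotone
in it, and `r` bounds the equation error `f_θ(x, w) - e_θ(ξ)` in the dual metric. -/
theorem InTheta.exists_metric (h : InTheta φ ψ C N δ Pi θ r) :
    ∃ P : Matrix (Fin nx) (Fin nx) ℝ,
      (∀ Δ : Vec nx, δ * ‖Δ‖ ^ 2 ≤ Δ.ofLp ⬝ᵥ P *ᵥ Δ.ofLp) ∧
      (∀ x Δ : Vec nx,
        Δ.ofLp ⬝ᵥ P *ᵥ Δ.ofLp ≤ 2 * inner ℝ Δ (eMap ψ θ (x + Δ) - eMap ψ θ x)) ∧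
      ∀ (ξ x : Vec nx) (w : Vec nw) (q : Vec nx),
        2 * inner ℝ q (fMap φ θ (x, w) - eMap ψ θ ξ) - q.ofLp ⬝ᵥ P *ᵥ q.ofLp ≤
          MvPolynomial.eval (stack ξ x w) r := by
  obtain ⟨-, P, S₁, S₂, ε, -, hP, hS₁, hS₂, hε, h1, h2⟩ := h
  refine ⟨P, fun Δ => ?_, fun x Δ => ?_, fun ξ x w q => ?_⟩
  · have := hP.dotProduct_mulVec_nonneg Δ.ofLp
    rw [star_trivial, sub_mulVec, dotProduct_sub, smul_mulVec, one_mulVec, dotProduct_smul,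
      dotProduct_self_eq_norm_sq, smul_eq_mul] at this
    linarith
  · have := hS₂.dotProduct_mulVec_nonneg (Pi (stackExt 0 x 0 Δ 0))
    rw [star_trivial, ← h2 0 x 0 Δ 0, add_mulVec, dotProduct_add, smul_mulVec, one_mulVec,
      dotProduct_smul, dotProduct_self_eq_norm_sq, smul_eq_mul] at this
    simp at this
    nlinarith [sq_nonneg ‖Δ‖]
  · have := hS₁.dotProduct_mulVec_nonneg (Pi (stackExt ξ x w 0 q))
    rw [star_trivial, ← h1 ξ x w 0 q] at this
    simp at this
    linarith

theorem InTheta.eMap_stronglyMonotone (h : InTheta φ ψ C N δ Pi θ r) (x Δ : Vec nx) :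
    δ / 2 * ‖Δ‖ ^ 2 ≤ inner ℝ Δ (eMap ψ θ (x + Δ) - eMap ψ θ x) := by
  obtain ⟨P, h1, h2, -⟩ := h.exists_metric
  linarith [h1 Δ, h2 x Δ]

theorem InTheta.eMap_implicitModel (hδ : 0 < δ) (hψ : ∀ i, AnalyticOnNhd ℝ (ψ i) Set.univ)
    (h : InTheta φ ψ C N δ Pi θ r) (p : Vec nx × Vec nw) :
    eMap ψ θ (implicitModel φ ψ θ p) = fMap φ θ p :=
  Function.rightInverse_invFun (surjective_of_stronglyMonotone (half_pos hδ)
    h.eMap_stronglyMonotone (analyticOnNhd_eMap hψ θ)) _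

theorem InTheta.analyticOnNhd_implicitModel (hδ : 0 < δ)
    (hφ : ∀ i, AnalyticOnNhd ℝ (φ i) Set.univ) (hψ : ∀ i, AnalyticOnNhd ℝ (ψ i) Set.univ)
    (h : InTheta φ ψ C N δ Pi θ r) : AnalyticOnNhd ℝ (implicitModel φ ψ θ) Set.univ := by
  intro p _
  have h1 := analyticAt_invFun_of_stronglyMonotone (half_pos hδ)
    h.eMap_stronglyMonotone (analyticOnNhd_eMap hψ θ) (fMap φ θ p)
  exact h1.comp (analyticOnNhd_fMap hφ θ p trivial)

theorem InTheta.eval_nonneg (h : InTheta φ ψ C N δ Pi θ r) (ξ x : Vec nx) (w : Vec nw) :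
    0 ≤ MvPolynomial.eval (stack ξ x w) r := by
  obtain ⟨P, -, -, h3⟩ := h.exists_metric
  simpa using h3 ξ x w 0

/-- The fidelity bound: `r` dominates the squared one-step prediction error of the model, with a
constant that depends on `δ` alone. -/
theorem InTheta.sq_error_le (hδ : 0 < δ) (hψ : ∀ i, AnalyticOnNhd ℝ (ψ i) Set.univ)
    (h : InTheta φ ψ C N δ Pi θ r) (ξ : Vec nx) (p : Vec nx × Vec nw) :
    δ / 4 * ‖implicitModel φ ψ θ p - ξ‖ ^ 2 ≤ MvPolynomial.eval (stack ξ p.1 p.2) r := by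
  have he := h.eMap_implicitModel hδ hψ p
  obtain ⟨P, h1, h2, h3⟩ := h.exists_metric
  set a := implicitModel φ ψ θ p
  -- In the direction `a - ξ` the multiplier `q = s (a - ξ)` yields `(s - s²) |a - ξ|²_P`, which is
  -- largest at `s = 1 / 2`.
  have h4 := h3 ξ p.1 p.2 ((1 / 2 : ℝ) • (a - ξ))
  have h5 := h2 ξ (a - ξ)
  rw [add_sub_cancel, he] at h5
  rw [real_inner_smul_left, WithLp.ofLp_smul, mulVec_smul, smul_dotProduct, dotProduct_smul,
    smul_eq_mul, smul_eq_mul] at h4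
  linarith [h1 (a - ξ)]

end Model

/-! ### Time averages, monomials and Gram matrices -/

/-- The average of the first `T` terms of a sequence; it is `0` when `T = 0`. -/
noncomputable def timeAverage (T : ℕ) (f : ℕ → ℝ) : ℝ := (1 / (T : ℝ)) * ∑ t ∈ Finset.range T, f t

theorem timeAverage_mono {T : ℕ} {f g : ℕ → ℝ} (h : ∀ t, f t ≤ g t) :
    timeAverage T f ≤ timeAverage T g :=
  mul_le_mul_of_nonneg_left (Finset.sum_le_sum fun t _ => h t) (by positivity)

theorem timeAverage_add (T : ℕ) (f g : ℕ → ℝ) :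
    timeAverage T (fun t => f t + g t) = timeAverage T f + timeAverage T g := by
  simp only [timeAverage, Finset.sum_add_distrib, mul_add]

theorem timeAverage_sub (T : ℕ) (f g : ℕ → ℝ) :
    timeAverage T (fun t => f t - g t) = timeAverage T f - timeAverage T g := by
  simp only [timeAverage, Finset.sum_sub_distrib, mul_sub]

theorem timeAverage_const_mul (T : ℕ) (c : ℝ) (f : ℕ → ℝ) :
    timeAverage T (fun t => c * f t) = c * timeAverage T f := by
  simp only [timeAverage, ← Finset.mul_sum]
  ring

theorem timeAverage_sum {ι : Type*} (s : Finset ι) (T : ℕ) (f : ι → ℕ → ℝ) :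
    timeAverage T (fun t => ∑ i ∈ s, f i t) = ∑ i ∈ s, timeAverage T (f i) := by
  simp only [timeAverage, ← Finset.mul_sum]
  rw [Finset.sum_comm]

theorem timeAverage_const_le {T : ℕ} {c : ℝ} (hc : 0 ≤ c) : timeAverage T (fun _ => c) ≤ c := by
  rcases Nat.eq_zero_or_pos T with rfl | hT
  · simpa [timeAverage] using hc
  · have : (T : ℝ) ≠ 0 := by positivity
    simp [timeAverage, this]

theorem timeAverage_nonneg {T : ℕ} {f : ℕ → ℝ} (h : ∀ t, 0 ≤ f t) : 0 ≤ timeAverage T f :=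
  mul_nonneg (by positivity) (Finset.sum_nonneg fun t _ => h t)

theorem monom_add {nz : ℕ} (α β : Fin nz → ℕ) (z : Fin nz → ℝ) :
    monom (α + β) z = monom α z * monom β z := by
  simp [monom, pow_add, Finset.prod_mul_distrib]

theorem continuous_monom {nz : ℕ} (α : Fin nz → ℕ) : Continuous (monom α) := by
  unfold monom
  fun_prop

/-- The polynomial `z ↦ ∑ R_{αβ} z^{α + β}` with Gram matrix `R`. -/
noncomputable def gramPoly {nz N : ℕ} (R : Matrix (aleph nz N) (aleph nz N) ℝ) :
    MvPolynomial (Fin nz) ℝ :=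
  ∑ α, ∑ β, MvPolynomial.monomial (Finsupp.equivFunOnFinite.symm (α.1 + β.1)) (R α β)

theorem eval_gramPoly {nz N : ℕ} (R : Matrix (aleph nz N) (aleph nz N) ℝ) (z : Fin nz → ℝ) :
    MvPolynomial.eval z (gramPoly R) = ∑ α, ∑ β, R α β * monom (α.1 + β.1) z := by
  simp only [gramPoly, map_sum, MvPolynomial.eval_monomial, monom]
  refine Finset.sum_congr rfl fun α _ => Finset.sum_congr rfl fun β _ => ?_
  rw [Finsupp.prod_fintype _ _ (fun i => pow_zero _)]
  rfl

theorem eval_gramPoly_sub {nz N : ℕ} (R R' : Matrix (aleph nz N) (aleph nz N) ℝ)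
    (z : Fin nz → ℝ) : MvPolynomial.eval z (gramPoly (R - R')) =
      MvPolynomial.eval z (gramPoly R) - MvPolynomial.eval z (gramPoly R') := by
  simp only [eval_gramPoly, Matrix.sub_apply, sub_mul, Finset.sum_sub_distrib]

theorem abs_eval_gramPoly_le {nz N : ℕ} (R : Matrix (aleph nz N) (aleph nz N) ℝ) {z : Fin nz → ℝ}
    {c : ℝ} (hc : ∀ α β : aleph nz N, |monom (α.1 + β.1) z| ≤ c) :
    |MvPolynomial.eval z (gramPoly R)| ≤ c * ∑ α, ∑ β, |R α β| := by
  rw [eval_gramPoly, Finset.mul_sum]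
  refine (Finset.abs_sum_le_sum_abs _ _).trans (Finset.sum_le_sum fun α _ => ?_)
  rw [Finset.mul_sum]
  refine (Finset.abs_sum_le_sum_abs _ _).trans (Finset.sum_le_sum fun β _ => ?_)
  rw [abs_mul, mul_comm]
  exact mul_le_mul_of_nonneg_right (hc α β) (abs_nonneg _)

theorem exists_bound_monom {nz N : ℕ} {Z : Set (Fin nz → ℝ)} (hZ : IsCompact Z) :
    ∃ c : ℝ, 0 ≤ c ∧ ∀ z ∈ Z, ∀ α β : aleph nz N, |monom (α.1 + β.1) z| ≤ c := by
  have h : ∀ p : aleph nz N × aleph nz N, ∃ c : ℝ, ∀ z ∈ Z, ‖monom (p.1.1 + p.2.1) z‖ ≤ c :=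
    fun p => hZ.exists_bound_of_continuousOn (continuous_monom _).continuousOn
  choose c hc using h
  refine ⟨∑ p, |c p|, by positivity, fun z hz α β => ?_⟩
  have h1 := hc (α, β) z hz
  rw [Real.norm_eq_abs] at h1
  exact h1.trans ((le_abs_self _).trans
    (Finset.single_le_sum (f := fun p => |c p|) (fun _ _ => abs_nonneg _) (Finset.mem_univ (α, β))))

/-- The vector `z(t + 1) = [x(t + 1); x(t); w(t + 1)]` of a pair of infinite signals. -/
noncomputable def trajectory {nx nw : ℕ} (w : ℕ → Vec nw) (x : ℕ → Vec nx) (t : ℕ) :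
    Fin (nx + nx + nw) → ℝ :=
  stack (x (t + 1)) (x t) (w (t + 1))

theorem empMoment_eq_timeAverage {nx nw : ℕ} (w : ℕ → Vec nw) (x : ℕ → Vec nx) (T : ℕ)
    (α : Fin (nx + nx + nw) → ℕ) :
    empMoment w x T α = timeAverage T fun t => monom α (trajectory w x t) :=
  rfl

/-- The matrix of the empirical moments of a pair of signals. -/
noncomputable def empMomentMatrix {nx nw : ℕ} (N : ℕ) (w : ℕ → Vec nw) (x : ℕ → Vec nx) (T : ℕ) :
    Matrix (aleph (nx + nx + nw) N) (aleph (nx + nx + nw) N) ℝ :=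
  Matrix.of fun α β => empMoment w x T (α.1 + β.1)

theorem trace_mul_empMomentMatrix {nx nw N : ℕ} (w : ℕ → Vec nw) (x : ℕ → Vec nx) (T : ℕ)
    (R : Matrix (aleph (nx + nx + nw) N) (aleph (nx + nx + nw) N) ℝ) :
    (R * empMomentMatrix N w x T).trace =
      timeAverage T fun t => MvPolynomial.eval (trajectory w x t) (gramPoly R) := by
  simp only [eval_gramPoly, timeAverage_sum, timeAverage_const_mul, Matrix.trace, Matrix.diag,
    Matrix.mul_apply, empMomentMatrix, Matrix.of_apply, empMoment_eq_timeAverage]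
  exact Finset.sum_congr rfl fun α _ => Finset.sum_congr rfl fun β _ => by rw [add_comm β.1]

/-- A quadratic form in the moments of `z^{α + β}` is the moment of a squared polynomial. -/
theorem sum_mul_timeAverage_monom {nz : ℕ} {ι : Type*} [Fintype ι] (a : ι → Fin nz → ℕ)
    (c : ι → ℝ) (z : ℕ → Fin nz → ℝ) (T : ℕ) :
    ∑ i, ∑ j, c i * c j * timeAverage T (fun t => monom (a i + a j) (z t)) =
      timeAverage T fun t => (∑ i, c i * monom (a i) (z t)) ^ 2 := by
  simp only [← timeAverage_const_mul, ← timeAverage_sum, monom_add, sq, Finset.sum_mul_sum]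
  congr 1
  funext t
  exact Finset.sum_congr rfl fun i _ => Finset.sum_congr rfl fun j _ => by ring

theorem posSemidef_empMomentMatrix {nx nw : ℕ} (N : ℕ) (w : ℕ → Vec nw) (x : ℕ → Vec nx) (T : ℕ) :
    (empMomentMatrix N w x T).PosSemidef := by
  refine PosSemidef.of_dotProduct_mulVec_nonneg ?_ fun c => ?_
  · ext α β
    simp [empMomentMatrix, add_comm]
  · have h := sum_mul_timeAverage_monom (fun α : aleph (nx + nx + nw) N => α.1) c
      (trajectory w x) T
    have h2 : star c ⬝ᵥ empMomentMatrix N w x T *ᵥ c = ∑ α, ∑ β, c α * c β *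
        timeAverage T (fun t => monom (α.1 + β.1) (trajectory w x t)) := by
      simp only [dotProduct, mulVec, star_trivial, Finset.mul_sum, empMomentMatrix, Matrix.of_apply,
        empMoment_eq_timeAverage]
      exact Finset.sum_congr rfl fun i _ => Finset.sum_congr rfl fun j _ => by ring
    rw [h2, h]
    exact timeAverage_nonneg fun t => sq_nonneg _

/-! ### Persistence of excitation -/

/-- The Rayleigh quotient bound for the least eigenvalue. -/
theorem lambdaMin_mul_le {ι : Type*} [Fintype ι] [DecidableEq ι] {M : Matrix ι ι ℝ}
    (hM : M.IsHermitian) (c : ι → ℝ) : lambdaMin M * (c ⬝ᵥ c) ≤ c ⬝ᵥ M *ᵥ c := by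
  have hH : (M - lambdaMin M • (1 : Matrix ι ι ℝ)).IsHermitian := by
    refine hM.sub ?_
    simp [Matrix.IsHermitian]
  have hpsd : (M - lambdaMin M • (1 : Matrix ι ι ℝ)).PosSemidef := by
    rw [hH.posSemidef_iff_eigenvalues_nonneg]
    intro i
    have h1 : hH.eigenvalues i ∈ spectrum ℝ (M - algebraMap ℝ (Matrix ι ι ℝ) (lambdaMin M)) := by
      rw [Algebra.algebraMap_eq_smul_one, hH.spectrum_real_eq_range_eigenvalues]
      exact Set.mem_range_self i
    rw [← spectrum.sub_singleton_eq, Set.sub_singleton] at h1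
    obtain ⟨y, hy, hyi⟩ := h1
    have hfin : (spectrum ℝ M).Finite := by
      rw [hM.spectrum_real_eq_range_eigenvalues]
      exact Set.finite_range _
    have h2 : lambdaMin M ≤ y := csInf_le hfin.bddBelow hy
    simp only at hyi
    rw [Pi.zero_apply, ← hyi]
    linarith
  have h := hpsd.dotProduct_mulVec_nonneg c
  rw [star_trivial, sub_mulVec, dotProduct_sub, smul_mulVec, one_mulVec, dotProduct_smul,
    smul_eq_mul] at h
  linarith

section Excitation

variable {nx nw : ℕ} {a : Vec nx × Vec nw → Vec nx} {w : ℕ → Vec nw} {x : ℕ → Vec nx}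
  {π : Measure (Vec nx × Vec nw)}

theorem eval_eq_sum_monom {nz : ℕ} (q : MvPolynomial (Fin nz) ℝ) (z : Fin nz → ℝ) :
    MvPolynomial.eval z q = ∑ α : q.support.image (fun d : Fin nz →₀ ℕ => (d : Fin nz → ℕ)),
      q.coeff (Finsupp.equivFunOnFinite.symm α.1) * monom α.1 z := by
  rw [MvPolynomial.eval_eq', Finset.sum_coe_sort (q.support.image (fun d : Fin nz →₀ ℕ => (d : Fin nz → ℕ)))
    (fun α => q.coeff (Finsupp.equivFunOnFinite.symm α) * monom α z),
    Finset.sum_image (fun d _ d' _ h => DFunLike.coe_injective h)]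
  refine Finset.sum_congr rfl fun d _ => ?_
  rw [show Finsupp.equivFunOnFinite.symm (d : Fin nz → ℕ) = d from
    Finsupp.equivFunOnFinite.symm_apply_apply d]
  rfl

theorem integrable_eval
    (hint : ∀ α : Fin (nx + nx + nw) → ℕ,
      Integrable (fun p : Vec nx × Vec nw => monom α (stack (a p) p.1 p.2)) π)
    (q : MvPolynomial (Fin (nx + nx + nw)) ℝ) :
    Integrable (fun p : Vec nx × Vec nw => MvPolynomial.eval (stack (a p) p.1 p.2) q) π := by
  simp only [eval_eq_sum_monom q]
  exact integrable_finsetSum _ fun α _ => (hint α.1).const_mul _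

/-- Persistence of excitation, read off as an asymptotic lower bound for time averages of squared
polynomials. -/
theorem eventually_integral_sq_le
    (hint : ∀ α : Fin (nx + nx + nw) → ℕ,
      Integrable (fun p : Vec nx × Vec nw => monom α (stack (a p) p.1 p.2)) π)
    (hlim : ∀ A : Finset (Fin (nx + nx + nw) → ℕ),
      (0 : EReal) ≤ liminf (fun T : ℕ => ((lambdaMin (Matrix.of fun α β : A =>
        empMoment w x T (α.1 + β.1) -
          ∫ p : Vec nx × Vec nw, monom (α.1 + β.1) (stack (a p) p.1 p.2) ∂π) : ℝ) : EReal)) atTop)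
    (q : MvPolynomial (Fin (nx + nx + nw)) ℝ) {η : ℝ} (hη : 0 < η) :
    ∀ᶠ T in atTop, ∫ p : Vec nx × Vec nw, MvPolynomial.eval (stack (a p) p.1 p.2) q ^ 2 ∂π ≤
      timeAverage T (fun t => MvPolynomial.eval (trajectory w x t) q ^ 2) + η := by
  classical
  set A := q.support.image
    (fun d : Fin (nx + nx + nw) →₀ ℕ => (d : Fin (nx + nx + nw) → ℕ))
  set c : A → ℝ := fun α => q.coeff (Finsupp.equivFunOnFinite.symm α.1) with hc
  have hq : ∀ z, MvPolynomial.eval z q = ∑ α : A, c α * monom α.1 z := eval_eq_sum_monom q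
  set η' : ℝ := η / (c ⬝ᵥ c + 1) with hη'_def
  have hcc : 0 ≤ c ⬝ᵥ c := by
    rw [dotProduct]
    exact Finset.sum_nonneg fun i _ => mul_self_nonneg _
  have hη' : 0 < η' := by positivity
  have h0 : ((-η' : ℝ) : EReal) < liminf (fun T : ℕ => ((lambdaMin (Matrix.of fun α β : A =>
        empMoment w x T (α.1 + β.1) -
          ∫ p : Vec nx × Vec nw, monom (α.1 + β.1) (stack (a p) p.1 p.2) ∂π) : ℝ) : EReal))
        atTop := by
    refine lt_of_lt_of_le ?_ (hlim A)
    exact_mod_cast neg_neg_of_pos hη'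
  filter_upwards [eventually_lt_of_lt_liminf h0] with T hT
  have hT' := EReal.coe_lt_coe_iff.1 hT
  set M : Matrix A A ℝ := Matrix.of fun α β : A =>
        empMoment w x T (α.1 + β.1) -
          ∫ p : Vec nx × Vec nw, monom (α.1 + β.1) (stack (a p) p.1 p.2) ∂π with hM
  have hH : M.IsHermitian := by
    ext α β
    simp [hM, add_comm]
  have h1 := lambdaMin_mul_le hH c
  have hsq : ∫ p : Vec nx × Vec nw, MvPolynomial.eval (stack (a p) p.1 p.2) q ^ 2 ∂π =
      ∑ α : A, ∑ β : A, c α * c β *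
        ∫ p : Vec nx × Vec nw, monom (α.1 + β.1) (stack (a p) p.1 p.2) ∂π := by
    simp only [← integral_const_mul]
    have hi : ∀ α β : A, Integrable (fun p : Vec nx × Vec nw =>
        c α * c β * monom (α.1 + β.1) (stack (a p) p.1 p.2)) π := fun α β => (hint _).const_mul _
    simp only [← integral_finsetSum _ fun β _ => hi _ β]
    rw [← integral_finsetSum _ fun α _ => integrable_finsetSum _ fun β _ => hi α β]
    congr 1
    funext p
    simp only [hq, monom_add, sq, Finset.sum_mul_sum]
    exact Finset.sum_congr rfl fun i _ => Finset.sum_congr rfl fun j _ => by ring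
  have hquad : c ⬝ᵥ M *ᵥ c = timeAverage T (fun t => MvPolynomial.eval (trajectory w x t) q ^ 2) -
      ∫ p : Vec nx × Vec nw, MvPolynomial.eval (stack (a p) p.1 p.2) q ^ 2 ∂π := by
    rw [hsq]
    simp only [hq]
    rw [← sum_mul_timeAverage_monom (fun α : A => α.1) c (trajectory w x) T]
    simp only [← Finset.sum_sub_distrib]
    simp only [dotProduct, mulVec, Finset.mul_sum, hM, Matrix.of_apply, empMoment_eq_timeAverage]
    exact Finset.sum_congr rfl fun i _ => Finset.sum_congr rfl fun j _ => by ring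
  have h2 : η' * (c ⬝ᵥ c) ≤ η := by
    rw [hη'_def, div_mul_eq_mul_div, div_le_iff₀ (by positivity)]
    nlinarith
  rw [hquad] at h1
  nlinarith

theorem continuous_stack : Continuous fun p : Vec nx × Vec nx × Vec nw =>
    stack p.1 p.2.1 p.2.2 := by
  refine continuous_pi fun d => ?_
  unfold stack
  refine Fin.addCases (fun d => ?_) (fun d => ?_) d
  · refine Fin.addCases (fun d => ?_) (fun d => ?_) d <;> simp only [Fin.append_left,
      Fin.append_right] <;> fun_prop
  · simp only [Fin.append_right]
    fun_prop

theorem continuous_trajectory_apply {nx nw : ℕ} (t : ℕ) :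
    Continuous fun u : (ℕ → Vec nw) × (ℕ → Vec nx) => trajectory u.1 u.2 t :=
  continuous_stack.comp (by fun_prop :
    Continuous fun u : (ℕ → Vec nw) × (ℕ → Vec nx) => (u.2 (t + 1), u.2 t, u.1 (t + 1)))

/-- If the time averages of a nonnegative polynomial tend to zero (along a subsequence), then the
polynomial vanishes on the graph of `a` over a nonempty open set. It need not be a sum of squares of
polynomials: on bounded sets its square root is a uniform limit of polynomials. -/
theorem PersistentlyExciting.exists_isOpen_eval_eq_zero (hPE : PersistentlyExciting a w x)
    (ha : Continuous a) (G : MvPolynomial (Fin (nx + nx + nw)) ℝ)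
    (hG : ∀ ξ x w, 0 ≤ MvPolynomial.eval (stack ξ x w) G)
    (hbd : ∃ B, ∀ t, MvPolynomial.eval (trajectory w x t) G ≤ B) {τ : ℕ → ℕ}
    (hτ : Tendsto τ atTop atTop)
    (havg : ∀ η : ℝ, 0 < η → ∀ᶠ k in atTop,
      timeAverage (τ k) (fun t => MvPolynomial.eval (trajectory w x t) G) ≤ η) :
    ∃ U : Set (Vec nx × Vec nw), IsOpen U ∧ U.Nonempty ∧
      ∀ p ∈ U, MvPolynomial.eval (stack (a p) p.1 p.2) G = 0 := by
  obtain ⟨π, ⟨U, hUo, hUne, hUs⟩, hint, hlim⟩ := hPE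
  refine ⟨U, hUo, hUne, fun p₀ hp₀ => ?_⟩
  obtain ⟨B, hB⟩ := hbd
  set g : Vec nx × Vec nw → ℝ := fun p => MvPolynomial.eval (stack (a p) p.1 p.2) G with hg_def
  have hg : Continuous g := (MvPolynomial.continuous_eval G).comp
    (continuous_stack.comp (ha.prodMk (continuous_fst.prodMk continuous_snd)))
  by_contra hne
  have hpos : 0 < g p₀ := lt_of_le_of_ne (hG _ _ _) (Ne.symm hne)
  set M : ℝ := max B (g p₀ + 1)
  set c : ℝ := g p₀ / 2 with hc_def
  have hc : 0 < c := half_pos hpos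
  set V : Set (Vec nx × Vec nw) := U ∩ g ⁻¹' Set.Ioo c M
  have hVo : IsOpen V := hUo.inter (isOpen_Ioo.preimage hg)
  have hp₀V : p₀ ∈ V := ⟨hp₀, half_lt_self hpos,
    (lt_add_one _).trans_le (le_max_right _ _)⟩
  have hfin : IsFiniteMeasure π := by
    have h := hint 0
    simp only [monom, Pi.zero_apply, pow_zero, Finset.prod_const_one] at h
    exact (integrable_const_iff.1 h).resolve_left one_ne_zero
  have hVpos : 0 < π.real V :=
    ENNReal.toReal_pos (Measure.mem_support_iff_forall p₀ |>.1 (hUs hp₀) V (hVo.mem_nhds hp₀V)).ne'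
      (measure_ne_top _ _)
  set m := π.real V
  -- The smallness that the final inequality `(c / 2 - η²) m ≤ 5 η²` contradicts.
  set s : ℝ := c * m / (4 * (5 + m)) with hs_def
  have hs : 0 < s := by positivity
  have hsm : s * (5 + m) = c * m / 4 := by
    rw [hs_def]
    field_simp
  set η := √s
  have hη : 0 < η := Real.sqrt_pos.2 hs
  have hη2 : η ^ 2 = s := Real.sq_sqrt hs.le
  obtain ⟨f, hf⟩ := exists_polynomial_near_of_continuousOn 0 M Real.sqrt
    Real.continuous_sqrt.continuousOn η hη
  set q : MvPolynomial (Fin (nx + nx + nw)) ℝ := Polynomial.aeval G f with hq_def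
  have hq : ∀ z, MvPolynomial.eval z q = f.eval (MvPolynomial.eval z G) := by
    intro z
    have h := Polynomial.aeval_algHom_apply (MvPolynomial.aeval z) G f
    rw [Polynomial.coe_aeval_eq_eval, MvPolynomial.aeval_eq_eval] at h
    exact h.symm
  have hup : ∀ y ∈ Set.Icc 0 M, f.eval y ^ 2 ≤ 2 * y + 2 * s := by
    intro y hy
    have h1 := abs_lt.1 (hf y hy)
    have h2 := Real.sq_sqrt hy.1
    nlinarith [sq_nonneg (f.eval y - 2 * √y), sq_nonneg (f.eval y - √y)]
  have hlow : ∀ y ∈ Set.Icc 0 M, y / 2 - s ≤ f.eval y ^ 2 := by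
    intro y hy
    have h1 := abs_lt.1 (hf y hy)
    have h2 := Real.sq_sqrt hy.1
    nlinarith [sq_nonneg (2 * f.eval y - √y), sq_nonneg (f.eval y - √y)]
  have hI : (c / 2 - s) * m ≤
      ∫ p : Vec nx × Vec nw, MvPolynomial.eval (stack (a p) p.1 p.2) q ^ 2 ∂π := by
    have hi : Integrable (fun p : Vec nx × Vec nw =>
        MvPolynomial.eval (stack (a p) p.1 p.2) q ^ 2) π := by
      refine (integrable_eval hint (q ^ 2)).congr (ae_of_all _ fun p => ?_)
      exact map_pow _ q 2
    refine le_trans ?_ (setIntegral_le_integral (s := V) hi (ae_of_all _ fun p => sq_nonneg _))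
    refine setIntegral_ge_of_const_le_real hVo.measurableSet (measure_ne_top _ _) (fun p hp => ?_)
      hi.integrableOn
    rw [hq]
    have h1 := hlow (g p) ⟨hG _ _ _, hp.2.2.le⟩
    have h2 : c < g p := hp.2.1
    simp only [hg_def] at h1 h2
    linarith
  obtain ⟨k, hk1, hk2⟩ :=
    ((hτ.eventually (eventually_integral_sq_le hint hlim q hs)).and (havg s hs)).exists
  have h3 : timeAverage (τ k) (fun t => MvPolynomial.eval (trajectory w x t) q ^ 2) ≤
      2 * timeAverage (τ k) (fun t => MvPolynomial.eval (trajectory w x t) G) + 2 * s := by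
    have h4 : timeAverage (τ k) (fun t => MvPolynomial.eval (trajectory w x t) q ^ 2) ≤
        timeAverage (τ k) (fun t => 2 * MvPolynomial.eval (trajectory w x t) G + 2 * s) := by
      refine timeAverage_mono fun t => ?_
      rw [hq]
      exact hup _ ⟨hG _ _ _, (hB t).trans (le_max_left _ _)⟩
    rw [timeAverage_add, timeAverage_const_mul] at h4
    linarith [timeAverage_const_le (T := τ k) (mul_nonneg zero_le_two hs.le)]
  nlinarith [mul_pos hc hVpos]

end Excitation

/-! ### Small cost forces small prediction error -/

section Consistency

variable {nx nw ny nθ nPi N : ℕ} {φ : Fin nθ → Vec nx × Vec nw → Vec nx}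
  {ψ : Fin nθ → Vec nx → Vec nx} {C : Matrix (Fin ny) (Fin nx) ℝ} {δ κ : ℝ}
  {Pi : (Fin (nx + nx + nw + nx + nx) → ℝ) → Fin nPi → ℝ} {a : Vec nx × Vec nw → Vec nx}

theorem analyticOnNhd_eval_stack (ha : AnalyticOnNhd ℝ a Set.univ)
    (G : MvPolynomial (Fin (nx + nx + nw)) ℝ) :
    AnalyticOnNhd ℝ (fun p : Vec nx × Vec nw => MvPolynomial.eval (stack (a p) p.1 p.2) G)
      Set.univ := by
  intro p hp
  have hproj : ∀ {n : ℕ} {f : Vec nx × Vec nw → Vec n} (d : Fin n), AnalyticAt ℝ f p →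
      AnalyticAt ℝ (fun q => (f q).ofLp d) p := fun d hf =>
    ((EuclideanSpace.proj d : Vec _ →L[ℝ] ℝ).analyticAt _).comp hf
  have h : ∀ d, AnalyticAt ℝ (fun p : Vec nx × Vec nw => stack (a p) p.1 p.2 d) p := by
    intro d
    unfold stack
    refine Fin.addCases (fun d => ?_) (fun d => ?_) d
    · refine Fin.addCases (fun d => ?_) (fun d => ?_) d
      · simpa only [Fin.append_left] using hproj d (ha p hp)
      · simpa only [Fin.append_left, Fin.append_right] using hproj d analyticAt_fst
    · simpa only [Fin.append_right] using hproj d analyticAt_snd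
  exact AnalyticAt.aeval_mvPolynomial h G

theorem eval_gramPoly_eq_zero_of_isOpen {R : Matrix (aleph (nx + nx + nw) N)
    (aleph (nx + nx + nw) N) ℝ} (ha : AnalyticOnNhd ℝ a Set.univ)
    {U : Set (Vec nx × Vec nw)} (hU : IsOpen U) (hne : U.Nonempty)
    (h : ∀ p ∈ U, MvPolynomial.eval (stack (a p) p.1 p.2) (gramPoly R) = 0)
    (p : Vec nx × Vec nw) : MvPolynomial.eval (stack (a p) p.1 p.2) (gramPoly R) = 0 := by
  obtain ⟨p₀, hp₀⟩ := hne
  exact (analyticOnNhd_eval_stack ha (gramPoly R)).eqOn_zero_of_preconnected_of_eventuallyEq_zero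
    isPreconnected_univ (Set.mem_univ p₀)
    (by filter_upwards [hU.mem_nhds hp₀] with q hq using h q hq) (Set.mem_univ p)

theorem IsFeasible.eval_gramPoly_eq {θ : Fin nθ → ℝ} {r : MvPolynomial (Fin (nx + nx + nw)) ℝ}
    {R : Matrix (aleph (nx + nx + nw) N) (aleph (nx + nx + nw) N) ℝ}
    (h : IsFeasible φ ψ C N δ Pi κ θ r R) (z : Fin (nx + nx + nw) → ℝ) :
    MvPolynomial.eval z (gramPoly R) = MvPolynomial.eval z r := by
  rw [eval_gramPoly, h.2.2.1 z]

theorem exists_compact_trajectory (nx nw : ℕ) (B : ℝ) :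
    ∃ Z : Set (Fin (nx + nx + nw) → ℝ), IsCompact Z ∧ ∀ (w : ℕ → Vec nw) (x : ℕ → Vec nx),
      (∀ t, ‖w t‖ ≤ B) → (∀ t, ‖x t‖ ≤ B) → ∀ t, trajectory w x t ∈ Z := by
  refine ⟨(fun p : Vec nx × Vec nx × Vec nw => stack p.1 p.2.1 p.2.2) ''
      (Metric.closedBall 0 B ×ˢ Metric.closedBall 0 B ×ˢ Metric.closedBall 0 B),
    ((isCompact_closedBall _ _).prod
      ((isCompact_closedBall _ _).prod (isCompact_closedBall _ _))).image continuous_stack,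
    fun w x hw hx t => ⟨(x (t + 1), x t, w (t + 1)), ?_, rfl⟩⟩
  simp [hx, hw]

/-- For persistently exciting bounded signals, every feasible point of sufficiently small cost on a
sufficiently long stretch of data has a model close to `a` on `K`. The Gram matrices `R` range over
a compact set, whereas the parameters `θ` need not, so that the limit is taken in `R` alone; the
fidelity bound then controls the models. -/
theorem PersistentlyExciting.exists_cost_threshold {w : ℕ → Vec nw} {x : ℕ → Vec nx}
    (hPE : PersistentlyExciting a w x) (ha : AnalyticOnNhd ℝ a Set.univ) (hδ : 0 < δ)
    (hψ : ∀ i, AnalyticOnNhd ℝ (ψ i) Set.univ) {B : ℝ} (hw : ∀ t, ‖w t‖ ≤ B)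
    (hx : ∀ t, ‖x t‖ ≤ B) {K : Set (Vec nx × Vec nw)} (hK : IsCompact K) {ε : ℝ} (hε : 0 < ε) :
    ∃ η : ℝ, 0 < η ∧ ∃ T₀ : ℕ, ∀ T, T₀ ≤ T → ∀ θ r R, IsFeasible φ ψ C N δ Pi κ θ r R →
      (R * empMomentMatrix N w x T).trace < η → ∀ p ∈ K, ‖implicitModel φ ψ θ p - a p‖ ≤ ε := by
  by_contra! hcon
  choose τ hτ θ r R hfeas hcost p hpK hp using fun k : ℕ =>
    hcon (1 / ((k : ℝ) + 1)) (by positivity) k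
  obtain ⟨R₀, -, σ, hσ, hlim⟩ := (isCompact_Icc : IsCompact (Set.Icc
    (fun _ _ => -(κ + 1) : aleph (nx + nx + nw) N → aleph (nx + nx + nw) N → ℝ)
    (fun _ _ => κ + 1))).tendsto_subseq 
    (x := fun k α β => R k α β) (by
      intro k
      have hb : ∀ α β, |R k α β| ≤ κ + 1 := by
        intro α β
        have h1 : R k α β ^ 2 ≤ κ := by
          refine le_trans ?_ (hfeas k).2.2.2
          refine (Finset.single_le_sum (f := fun β => R k α β ^ 2) (fun _ _ => sq_nonneg _)
            (Finset.mem_univ β)).trans ?_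
          exact Finset.single_le_sum (f := fun α => ∑ β, R k α β ^ 2)
            (fun _ _ => Finset.sum_nonneg fun _ _ => sq_nonneg _) (Finset.mem_univ α)
        rw [← sq_abs] at h1
        nlinarith [abs_nonneg (R k α β), sq_nonneg (|R k α β| - 1)]
      exact ⟨fun α β => (abs_le.1 (hb α β)).1, fun α β => (abs_le.1 (hb α β)).2⟩)
  set S : Matrix (aleph (nx + nx + nw) N) (aleph (nx + nx + nw) N) ℝ := Matrix.of R₀ with hS
  have hentry : ∀ α β, Tendsto (fun k => R (σ k) α β) atTop (𝓝 (S α β)) := fun α β =>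
    ((continuous_apply β).tendsto _).comp (((continuous_apply α).tendsto _).comp hlim)
  have hdist : Tendsto (fun k => ∑ α, ∑ β, |(S - R (σ k)) α β|) atTop (𝓝 0) := by
    have h : Tendsto (fun k => ∑ α, ∑ β, |(S - R (σ k)) α β|) atTop
        (𝓝 (∑ α : aleph (nx + nx + nw) N, ∑ β : aleph (nx + nx + nw) N, |S α β - S α β|)) :=
      tendsto_finsetSum _ fun α _ => tendsto_finsetSum _ fun β _ =>
        (tendsto_const_nhds.sub (hentry α β)).abs
    simpa using h
  have hnonneg : ∀ ξ x w, 0 ≤ MvPolynomial.eval (stack ξ x w) (gramPoly S) := by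
    intro ξ x w
    have h : Tendsto (fun k => MvPolynomial.eval (stack ξ x w) (gramPoly (R (σ k)))) atTop
        (𝓝 (MvPolynomial.eval (stack ξ x w) (gramPoly S))) := by
      simp only [eval_gramPoly]
      exact tendsto_finsetSum _ fun α _ => tendsto_finsetSum _ fun β _ =>
        (hentry α β).mul_const _
    refine ge_of_tendsto' h fun k => ?_
    rw [(hfeas _).eval_gramPoly_eq]
    exact (hfeas _).1.eval_nonneg ξ x w
  obtain ⟨Z, hZ, hZmem⟩ := exists_compact_trajectory nx nw B
  replace hZmem := hZmem w x hw hx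
  obtain ⟨c, hc0, hc⟩ := exists_bound_monom (N := N) hZ
  have hτσ : Tendsto (fun k => τ (σ k)) atTop atTop :=
    (tendsto_atTop_mono hτ tendsto_id).comp hσ.tendsto_atTop
  obtain ⟨U, hUo, hUne, hU⟩ := hPE.exists_isOpen_eval_eq_zero
    (continuousOn_univ.1 ha.continuousOn) (gramPoly S) hnonneg
    ⟨c * ∑ α, ∑ β, |S α β|, fun t => (le_abs_self _).trans
      (abs_eval_gramPoly_le S (hc _ (hZmem t)))⟩ hτσ (by
      intro η hη
      have h1 : Tendsto (fun k => 1 / ((σ k : ℝ) + 1) + c * ∑ α, ∑ β, |(S - R (σ k)) α β|) atTop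
          (𝓝 (0 + c * 0)) :=
        (tendsto_one_div_add_atTop_nhds_zero_nat.comp hσ.tendsto_atTop).add (hdist.const_mul c)
      rw [mul_zero, add_zero] at h1
      filter_upwards [h1.eventually_lt_const hη] with k hk
      have h2 := hcost (σ k)
      rw [trace_mul_empMomentMatrix] at h2
      have h3 : timeAverage (τ (σ k))
          (fun t => MvPolynomial.eval (trajectory w x t) (gramPoly (S - R (σ k)))) ≤
          c * ∑ α, ∑ β, |(S - R (σ k)) α β| := by
        refine le_trans (timeAverage_mono fun t => (le_abs_self _).trans
          (abs_eval_gramPoly_le _ (hc _ (hZmem t)))) (timeAverage_const_le ?_)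
        exact mul_nonneg hc0 (Finset.sum_nonneg fun _ _ => Finset.sum_nonneg fun _ _ =>
          abs_nonneg _)
      simp only [eval_gramPoly_sub, timeAverage_sub] at h3
      linarith)
  have hzero := eval_gramPoly_eq_zero_of_isOpen ha hUo hUne hU
  obtain ⟨c', -, hc'⟩ := exists_bound_monom (N := N) (hK.image (continuous_stack.comp
    ((continuousOn_univ.1 ha.continuousOn).prodMk (continuous_fst.prodMk continuous_snd))))
  have h1 := hdist.const_mul c'
  rw [mul_zero] at h1
  obtain ⟨k, hk⟩ := (h1.eventually_lt_const (show 0 < δ / 4 * ε ^ 2 by positivity)).exists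
  have h2 := (hfeas (σ k)).1.sq_error_le hδ hψ (a (p (σ k))) (p (σ k))
  have h3 := (le_abs_self _).trans (abs_eval_gramPoly_le (R (σ k) - S)
    (hc' _ (Set.mem_image_of_mem _ (hpK (σ k)))))
  have h4 : ∑ α, ∑ β, |(R (σ k) - S) α β| = ∑ α, ∑ β, |(S - R (σ k)) α β| := by
    simp only [Matrix.sub_apply, abs_sub_comm]
  rw [eval_gramPoly_sub, h4] at h3
  simp only [Function.comp_apply, hzero, sub_zero] at h3
  rw [(hfeas _).eval_gramPoly_eq] at h3
  have h5 := hp (σ k)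
  have h6 : ε ^ 2 < ‖implicitModel φ ψ (θ (σ k)) (p (σ k)) - a (p (σ k))‖ ^ 2 := by gcongr
  nlinarith

end Consistency

/-! ### The multilinear moment functions -/

section Multilinear

variable {nz N : ℕ}

/-- The coordinate `β(i)` that the `i`-th factor of `pFun α` reads, if there is one. -/
noncomputable def slot (α : Fin nz → ℕ) (i : ℕ) : Option (Fin nz) :=
  if h : ∃ d : Fin nz, i < ∑ j ∈ Finset.Iic d, α j then
    some (Fin.find (fun d : Fin nz => i < ∑ j ∈ Finset.Iic d, α j) h) else none

theorem pFun_eq_prod_elim (α : Fin nz → ℕ) (z : Fin N → Fin nz → ℝ) :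
    pFun α z = ∏ i : Fin N, (slot α i).elim 1 (z i) := by
  unfold pFun slot
  refine Finset.prod_congr rfl fun i _ => ?_
  split_ifs <;> rfl

theorem continuous_pFun (α : Fin nz → ℕ) :
    Continuous (pFun α : (Fin N → Fin nz → ℝ) → ℝ) := by
  simp only [funext (pFun_eq_prod_elim (N := N) α)]
  refine continuous_finsetProd _ fun i _ => ?_
  cases slot α i with
  | none => exact continuous_const
  | some d => exact (continuous_apply d).comp (continuous_apply i)

theorem slot_eq_some_iff (α : Fin nz → ℕ) (i : ℕ) (d : Fin nz) :
    slot α i = some d ↔ ∑ j ∈ Finset.Iio d, α j ≤ i ∧ i < ∑ j ∈ Finset.Iic d, α j := by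
  have hlow : ∑ j ∈ Finset.Iio d, α j ≤ i ↔
      ∀ e < d, ¬ i < ∑ j ∈ Finset.Iic e, α j := by
    constructor
    · intro h e he
      refine not_lt.2 (le_trans (Finset.sum_le_sum_of_subset fun j hj => ?_) h)
      exact Finset.mem_Iio.2 ((Finset.mem_Iic.1 hj).trans_lt he)
    · intro h
      obtain ⟨k, hk⟩ := d
      rcases k with - | k
      · have : Finset.Iio (⟨0, hk⟩ : Fin nz) = ∅ := by
          ext j
          simp [Fin.lt_def]
        simp [this]
      · have : Finset.Iio (⟨k + 1, hk⟩ : Fin nz) = Finset.Iic ⟨k, by omega⟩ := by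
          ext j
          simp [Fin.lt_def, Fin.le_def]
        rw [this]
        exact not_lt.1 (h ⟨k, by omega⟩ (by simp [Fin.lt_def]))
  rw [hlow]
  unfold slot
  split_ifs with h
  · rw [Option.some.injEq, Fin.find_eq_iff, and_comm]
  · simp only [false_iff, not_and]
    exact fun _ hd => h ⟨d, hd⟩

/-- On the diagonal the multilinear function `p_α` is the monomial `z^α`, because exactly `α_d` of
its factors read the coordinate `d`. -/
theorem pFun_diagonal {α : Fin nz → ℕ} (hα : ∑ d, α d ≤ N) (z : Fin nz → ℝ) :
    pFun α (fun _ : Fin N => z) = monom α z := by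
  have hcard : ∀ d, (Finset.univ.filter fun i : Fin N => slot α i = some d).card = α d := by
    intro d
    have hIic : ∑ j ∈ Finset.Iic d, α j = ∑ j ∈ Finset.Iio d, α j + α d := by
      rw [← Finset.Iio_insert, Finset.sum_insert (by simp), add_comm]
    have hle : ∑ j ∈ Finset.Iic d, α j ≤ N :=
      (Finset.sum_le_sum_of_subset (Finset.subset_univ _)).trans hα
    have himg : (Finset.univ.filter fun i : Fin N => slot α i = some d).map Fin.valEmbedding =
        Finset.Ico (∑ j ∈ Finset.Iio d, α j) (∑ j ∈ Finset.Iic d, α j) := by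
      ext k
      simp only [Finset.mem_map, Finset.mem_filter, Finset.mem_univ, true_and, slot_eq_some_iff,
        Finset.mem_Ico, Fin.valEmbedding_apply]
      exact ⟨fun ⟨i, hi, h⟩ => h ▸ hi, fun h => ⟨⟨k, h.2.trans_le hle⟩, h, rfl⟩⟩
    rw [← Finset.card_map Fin.valEmbedding, himg, Nat.card_Ico]
    omega
  rw [pFun_eq_prod_elim]
  have h : ∀ i : Fin N, (slot α i).elim 1 z = ∏ d, if slot α i = some d then z d else 1 := by
    intro i
    cases slot α i with
    | none => simp
    | some e => simp
  simp only [h]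
  rw [Finset.prod_comm]
  refine Finset.prod_congr rfl fun d _ => ?_
  rw [Finset.prod_ite, Finset.prod_const, Finset.prod_const_one, mul_one, hcard]

theorem linMoment_restrict {nx nw : ℕ} (w : ℕ → Vec nw) (x : Fin N → ℕ → Vec nx) (T : ℕ)
    (α : Fin (nx + nx + nw) → ℕ) : linMoment (DataSet.restrict w x T) α =
      timeAverage T fun t => pFun α fun i => trajectory w (x i) t := by
  unfold linMoment timeAverage
  rw [← Fin.sum_univ_eq_sum_range (fun t => pFun α fun i => trajectory w (x i) t)]
  rfl

/-- Every factor of `p_α` depends on the noise through a linear functional of its value at a single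
time. -/
theorem exists_noise_functional {nx nw : ℕ} (o : Option (Fin (nx + nx + nw))) :
    ∃ (b : ℕ) (ℓ : Vec nx →L[ℝ] ℝ), ∀ (w : ℕ → Vec nw) (x ν : ℕ → Vec nx) (t : ℕ),
      o.elim 1 (trajectory w (fun s => x s + ν s) t) =
        o.elim 1 (trajectory w x t) + ℓ (ν (t + b)) := by
  cases o with
  | none => exact ⟨0, 0, by simp⟩
  | some d =>
    simp only [Option.elim_some, trajectory, stack]
    refine Fin.addCases (fun d => ?_) (fun d => ?_) d
    · refine Fin.addCases (fun d => ?_) (fun d => ?_) d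
      · refine ⟨1, EuclideanSpace.proj d, fun w x ν t => ?_⟩
        simp only [Fin.append_left]
        rfl
      · refine ⟨0, EuclideanSpace.proj d, fun w x ν t => ?_⟩
        simp only [Fin.append_left, Fin.append_right]
        rfl
    · exact ⟨0, 0, by simp⟩

end Multilinear

/-! ### Convergence of the empirical moments in probability -/

section Probability

variable {Ω : Type*} [MeasurableSpace Ω] {μ : Measure Ω}

theorem indepFun_prod_slice {ι : Type*} [Fintype ι] {F : ι → ℕ → Ω → ℝ}
    (hF : iIndepFun (fun p : ι × ℕ => F p.1 p.2) μ) (hm : ∀ i t, Measurable (F i t)) {s t : ℕ}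
    (hst : s ≠ t) : IndepFun (fun ω => ∏ i, F i s ω) (fun ω => ∏ i, F i t ω) μ := by
  classical
  set A : ℕ → Finset (ι × ℕ) := fun s => Finset.univ.image fun i => (i, s) with hA
  have hmem : ∀ s i, (i, s) ∈ A s := fun s i => Finset.mem_image_of_mem _ (Finset.mem_univ i)
  have hdisj : Disjoint (A s) (A t) := by
    rw [Finset.disjoint_left]
    rintro ⟨i, k⟩ h1 h2
    simp only [hA, Finset.mem_image, Finset.mem_univ, true_and, Prod.mk.injEq] at h1 h2
    obtain ⟨-, -, h1⟩ := h1
    obtain ⟨-, -, h2⟩ := h2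
    exact hst (h1.trans h2.symm)
  have h := (hF.indepFun_finset (A s) (A t) hdisj fun p => hm p.1 p.2).comp
    (φ := fun u : A s → ℝ => ∏ i, u ⟨(i, s), hmem s i⟩)
    (ψ := fun u : A t → ℝ => ∏ i, u ⟨(i, t), hmem t i⟩)
    (Finset.measurable_fun_prod _ fun i _ => measurable_pi_apply _)
    (Finset.measurable_fun_prod _ fun i _ => measurable_pi_apply _)
  exact h

variable [IsProbabilityMeasure μ]

theorem variance_timeAverage_le {X : ℕ → Ω → ℝ} {c : ℝ} (hm : ∀ t, Measurable (X t))
    (hb : ∀ t, ∀ᵐ ω ∂μ, |X t ω| ≤ c) (hind : Pairwise fun s t => IndepFun (X s) (X t) μ) (T : ℕ) :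
    variance (fun ω => timeAverage T fun t => X t ω) μ ≤ c ^ 2 / T := by
  have hL : ∀ t, MemLp (X t) 2 μ := fun t =>
    MemLp.of_bound (hm t).aestronglyMeasurable c (hb t)
  have hv : ∀ t, variance (X t) μ ≤ c ^ 2 := fun t => by
    have h := variance_le_sq_of_bounded (a := -c) (b := c) (X := X t) (μ := μ)
      (by filter_upwards [hb t] with ω hω using abs_le.1 hω) (hm t).aemeasurable
    rwa [show (c - -c) / 2 = c by ring] at h
  have h1 : (fun ω => timeAverage T fun t => X t ω) =
      fun ω => (1 / (T : ℝ)) * (∑ t ∈ Finset.range T, X t) ω := by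
    funext ω
    simp [timeAverage]
  rw [h1, variance_const_mul, IndepFun.variance_sum (fun t _ => hL t) fun s _ t _ h => hind h]
  rcases Nat.eq_zero_or_pos T with rfl | hT
  · simp
  · have hT' : (0 : ℝ) < T := by exact_mod_cast hT
    calc (1 / (T : ℝ)) ^ 2 * ∑ t ∈ Finset.range T, variance (X t) μ
        ≤ (1 / (T : ℝ)) ^ 2 * ∑ t ∈ Finset.range T, c ^ 2 := by
          gcongr with t
          exact hv t
      _ = c ^ 2 / T := by
          rw [Finset.sum_const, Finset.card_range, nsmul_eq_mul]
          field_simp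

variable {nx nw N : ℕ}

/-- The linearized moments of noisy data concentrate, at fixed input and true states, around those
of the true states: as each experiment enters `p_α` through one factor only, the expectation of a
term is `p_α` of the true states, and terms at different times are independent. -/
theorem exists_measure_linMoment_le {v : Fin N → ℕ → Ω → Vec nx}
    (hvm : ∀ i t, Measurable (v i t)) {b : ℝ} (hvb : ∀ i t, ∀ᵐ ω ∂μ, ‖v i t ω‖ ≤ b)
    (hv0 : ∀ i t, ∫ ω, v i t ω ∂μ = 0)
    (hvi : iIndepFun (fun (p : Fin N × ℕ) ω => v p.1 p.2 ω) μ)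
    {w : ℕ → Vec nw} {x : Fin N → ℕ → Vec nx} {B : ℝ} (hw : ∀ t, ‖w t‖ ≤ B)
    (hx : ∀ i t, ‖x i t‖ ≤ B) (α : Fin (nx + nx + nw) → ℕ) :
    ∃ c : ℝ, ∀ (T : ℕ) (η : ℝ), 0 < η →
      μ {ω | η ≤ |linMoment (DataSet.restrict w (fun i t => x i t + v i t ω) T) α -
        linMoment (DataSet.restrict w x T) α|} ≤ ENNReal.ofReal (c ^ 2 / T / η ^ 2) := by
  choose s ℓ hℓ using fun i : Fin N => exists_noise_functional (nx := nx) (nw := nw) (slot α i)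
  set F : Fin N → ℕ → Ω → ℝ := fun i t ω =>
    (slot α i).elim 1 (trajectory w (x i) t) + ℓ i (v i (t + s i) ω) with hF
  have hFm : ∀ i t, Measurable (F i t) := fun i t =>
    measurable_const.add ((ℓ i).continuous.measurable.comp (hvm i _))
  have hvint : ∀ i t, Integrable (v i t) μ := fun i t =>
    (MemLp.of_bound (hvm i t).aestronglyMeasurable b (hvb i t)).integrable le_top
  have hFind : iIndepFun (fun p : Fin N × ℕ => F p.1 p.2) μ := by
    have hinj : Function.Injective fun p : Fin N × ℕ => (p.1, p.2 + s p.1) := by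
      rintro ⟨i, t⟩ ⟨j, t'⟩ h
      simp only [Prod.mk.injEq] at h
      obtain ⟨rfl, h⟩ := h
      exact Prod.ext rfl (by simpa using h)
    exact (hvi.precomp hinj).comp
      (fun p y => (slot α p.1).elim 1 (trajectory w (x p.1) p.2) + ℓ p.1 y)
      (fun p => measurable_const.add (ℓ p.1).continuous.measurable)
  have hFmean : ∀ i t, ∫ ω, F i t ω ∂μ = (slot α i).elim 1 (trajectory w (x i) t) := by
    intro i t
    have hi : Integrable (fun ω => ℓ i (v i (t + s i) ω)) μ := (ℓ i).integrable_comp (hvint i _)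
    rw [hF]
    simp only
    rw [integral_add (integrable_const _) hi, integral_const, probReal_univ, one_smul,
      (ℓ i).integral_comp_comm (hvint i _), hv0, map_zero, add_zero]
  have hpF : ∀ t ω, pFun α (fun i => trajectory w (fun t => x i t + v i t ω) t) = ∏ i, F i t ω := by
    intro t ω
    rw [pFun_eq_prod_elim]
    exact Finset.prod_congr rfl fun i _ => hℓ i w (x i) (fun t => v i t ω) t
  obtain ⟨c₀, hc₀⟩ : ∃ c₀ : ℝ, ∀ i t, ∀ᵐ ω ∂μ, |F i t ω| ≤ c₀ := by
    obtain ⟨Z, hZ, hZmem⟩ := exists_compact_trajectory nx nw (B + |b|)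
    obtain ⟨c, hc⟩ := hZ.isBounded.exists_norm_le
    refine ⟨max 1 c, fun i t => ?_⟩
    filter_upwards [ae_all_iff.2 (hvb i)] with ω hω
    have hz := hc _ (hZmem w (fun t => x i t + v i t ω)
      (fun t => (hw t).trans (le_add_of_nonneg_right (abs_nonneg b)))
      (fun t => (norm_add_le _ _).trans (add_le_add (hx i t) ((hω t).trans (le_abs_self b)))) t)
    rw [show F i t ω = (slot α i).elim 1 (trajectory w (fun t => x i t + v i t ω) t) from
      (hℓ i w (x i) (fun t => v i t ω) t).symm]
    cases slot α i with
    | none => simp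
    | some d => exact ((norm_le_pi_norm _ d).trans hz).trans (le_max_right _ _)
  have hX : ∀ t, ∀ᵐ ω ∂μ, |∏ i, F i t ω| ≤ c₀ ^ N := by
    intro t
    filter_upwards [ae_all_iff.2 fun i => hc₀ i t] with ω hω
    rw [Finset.abs_prod]
    refine (Finset.prod_le_prod (fun _ _ => abs_nonneg _) fun i _ => hω i).trans ?_
    simp
  have hXm : ∀ t, Measurable fun ω => ∏ i, F i t ω := fun t =>
    Finset.measurable_fun_prod _ fun i _ => hFm i t
  have hXL : ∀ t, MemLp (fun ω => ∏ i, F i t ω) 2 μ := fun t =>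
    MemLp.of_bound (hXm t).aestronglyMeasurable _ (hX t)
  have hmean : ∀ T, ∫ ω, timeAverage T (fun t => ∏ i, F i t ω) ∂μ =
      linMoment (DataSet.restrict w x T) α := by
    intro T
    rw [linMoment_restrict]
    unfold timeAverage
    rw [integral_const_mul, integral_finsetSum _ fun t _ => (hXL t).integrable one_le_two]
    congr 1
    refine Finset.sum_congr rfl fun t _ => ?_
    simp only
    rw [pFun_eq_prod_elim, iIndepFun.integral_fun_prod_eq_prod_integral
      (hFind.precomp (g := fun i : Fin N => (i, t)) fun i j h => (Prod.ext_iff.1 h).1)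
      fun i => (hFm i t).aestronglyMeasurable]
    exact Finset.prod_congr rfl fun i _ => hFmean i t
  refine ⟨c₀ ^ N, fun T η hη => ?_⟩
  have hAL : MemLp (fun ω => timeAverage T (fun t => ∏ i, F i t ω)) 2 μ := by
    unfold timeAverage
    exact (memLp_finsetSum _ fun t _ => hXL t).const_mul _
  have h := meas_ge_le_variance_div_sq hAL hη
  simp only [hmean] at h
  simp only [linMoment_restrict w _ T α, hpF] at h ⊢
  refine h.trans (ENNReal.ofReal_le_ofReal ?_)
  gcongr
  exact variance_timeAverage_le hXm hX (fun s t hst => indepFun_prod_slice hFind hFm hst) T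

end Probability

section Deterministic

variable {nx nw N : ℕ}

theorem tendsto_sub_of_continuous {E : Type*} [SeminormedAddCommGroup E] {f : E → ℝ}
    (hf : Continuous f) {Z : Set E} (hZ : IsCompact Z) {u v : ℕ → E} (hu : ∀ t, u t ∈ Z)
    (hv : ∀ t, v t ∈ Z) (h : Tendsto (fun t => u t - v t) atTop (𝓝 0)) :
    Tendsto (fun t => f (u t) - f (v t)) atTop (𝓝 0) := by
  have huc := Metric.uniformContinuousOn_iff.1 (hZ.uniformContinuousOn_of_continuous hf.continuousOn)
  rw [Metric.tendsto_atTop] at h ⊢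
  intro ε hε
  obtain ⟨δ, hδ, hδε⟩ := huc ε hε
  obtain ⟨T, hT⟩ := h δ hδ
  refine ⟨T, fun t ht => ?_⟩
  have h1 := hδε (u t) (hu t) (v t) (hv t) (by simpa [dist_eq_norm] using hT t ht)
  simpa [dist_eq_norm] using h1

/-- If all experiments approach the experiment `i₀`, then their linearized moments approach its
moments. -/
theorem tendsto_linMoment_sub_empMoment {w : ℕ → Vec nw} {x : Fin N → ℕ → Vec nx} {B : ℝ}
    (hw : ∀ t, ‖w t‖ ≤ B) (hx : ∀ i t, ‖x i t‖ ≤ B) (i₀ : Fin N)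
    (hconv : ∀ i, Tendsto (fun t => x i t - x i₀ t) atTop (𝓝 0))
    {α : Fin (nx + nx + nw) → ℕ} (hα : ∑ d, α d ≤ N) :
    Tendsto (fun T => linMoment (DataSet.restrict w x T) α - empMoment w (x i₀) T α) atTop
      (𝓝 0) := by
  set f : (Fin N → Vec nx × Vec nx × Vec nw) → ℝ := fun u =>
    pFun α fun i => stack (u i).1 (u i).2.1 (u i).2.2 with hf_def
  have hf : Continuous f := (continuous_pFun α).comp (continuous_pi fun i =>
    continuous_stack.comp (continuous_apply i))
  set Z : Set (Fin N → Vec nx × Vec nx × Vec nw) := Set.univ.pi fun _ =>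
    Metric.closedBall 0 B ×ˢ Metric.closedBall 0 B ×ˢ Metric.closedBall 0 B
  have hZ : IsCompact Z := isCompact_univ_pi fun _ => (isCompact_closedBall _ _).prod
    ((isCompact_closedBall _ _).prod (isCompact_closedBall _ _))
  have h0 := tendsto_sub_of_continuous hf hZ
    (u := fun t i => (x i (t + 1), x i t, w (t + 1)))
    (v := fun t _ => (x i₀ (t + 1), x i₀ t, w (t + 1)))
    (fun t i _ => by simp [hw, hx]) (fun t i _ => by simp [hw, hx]) (by
      refine tendsto_pi_nhds.2 fun i => ?_
      have h1 := ((tendsto_add_atTop_iff_nat 1).2 (hconv i)).prodMk_nhds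
        ((hconv i).prodMk_nhds (tendsto_const_nhds (x := (0 : Vec nw))))
      refine h1.congr fun t => ?_
      simp)
  refine h0.cesaro.congr fun T => ?_
  rw [linMoment_restrict, empMoment_eq_timeAverage, ← timeAverage_sub, timeAverage, one_div]
  congr 1
  refine Finset.sum_congr rfl fun t _ => ?_
  rw [hf_def, ← pFun_diagonal (N := N) hα]
  rfl

/-! ### Optimal points -/

theorem abs_trace_mul_le {ι : Type*} [Fintype ι] (R X : Matrix ι ι ℝ) {κ : ℝ}
    (hR : frobSq R ≤ κ) : |(R * X).trace| ≤ √(κ * frobSq X) := by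
  refine Real.abs_le_sqrt ?_
  have hX : frobSq X = ∑ p : ι × ι, X p.2 p.1 ^ 2 := by
    rw [Fintype.sum_prod_type, frobSq, Finset.sum_comm]
  have hR' : frobSq R = ∑ p : ι × ι, R p.1 p.2 ^ 2 := by
    rw [Fintype.sum_prod_type, frobSq]
  have ht : (R * X).trace = ∑ p : ι × ι, R p.1 p.2 * X p.2 p.1 := by
    rw [Fintype.sum_prod_type]
    rfl
  rw [ht]
  refine (Finset.sum_mul_sq_le_sq_mul_sq _ _ _).trans ?_
  rw [← hR', ← hX]
  refine mul_le_mul_of_nonneg_right hR ?_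
  rw [hX]
  exact Finset.sum_nonneg fun _ _ => sq_nonneg _

theorem frobSq_nonneg {ι : Type*} [Fintype ι] (X : Matrix ι ι ℝ) : 0 ≤ frobSq X :=
  Finset.sum_nonneg fun _ _ => Finset.sum_nonneg fun _ _ => sq_nonneg _

theorem frobSq_sub_le {ι : Type*} [Fintype ι] (S X Y : Matrix ι ι ℝ) :
    frobSq (X - Y) ≤ 2 * frobSq (S - X) + 2 * frobSq (S - Y) := by
  simp only [frobSq, Finset.mul_sum, ← Finset.sum_add_distrib]
  refine Finset.sum_le_sum fun i _ => Finset.sum_le_sum fun j _ => ?_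
  simp only [Matrix.sub_apply]
  nlinarith [sq_nonneg ((S i j - X i j) + (S i j - Y i j))]

/-- An output of the algorithm has small cost also with respect to any positive semidefinite matrix
`E` near the data matrix, if some feasible point has zero cost for `E`. -/
theorem IsAlgorithmOutput.exists_trace_le {ny nθ nPi T : ℕ} {φ : Fin nθ → Vec nx × Vec nw → Vec nx}
    {ψ : Fin nθ → Vec nx → Vec nx} {C : Matrix (Fin ny) (Fin nx) ℝ} {δ κ : ℝ}
    {Pi : (Fin (nx + nx + nw + nx + nx) → ℝ) → Fin nPi → ℝ} {Ξ : DataSet nx nw N T}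
    {θ θ₀ : Fin nθ → ℝ} {r₀ : MvPolynomial (Fin (nx + nx + nw)) ℝ}
    {R₀ E : Matrix (aleph (nx + nx + nw) N) (aleph (nx + nx + nw) N) ℝ}
    (hout : IsAlgorithmOutput φ ψ C δ Pi κ Ξ θ) (h₀ : IsFeasible φ ψ C N δ Pi κ θ₀ r₀ R₀)
    (hE : E.PosSemidef) (htr : (R₀ * E).trace = 0) :
    ∃ r R, IsFeasible φ ψ C N δ Pi κ θ r R ∧
      (R * E).trace ≤ 4 * √(κ * frobSq (momentMatrix Ξ - E)) := by
  obtain ⟨Mhat, r, R, ⟨-, hproj⟩, hR, hopt⟩ := hout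
  refine ⟨r, R, hR, ?_⟩
  have hsymm : (1 / 2 : ℝ) • (momentMatrix Ξ + (momentMatrix Ξ)ᵀ) = momentMatrix Ξ := by
    ext α β
    simp only [momentMatrix, Matrix.smul_apply, Matrix.add_apply, Matrix.transpose_apply,
      Matrix.of_apply, smul_eq_mul, add_comm β.1]
    ring
  rw [hsymm] at hproj
  have hκ : 0 ≤ κ := (frobSq_nonneg R).trans hR.2.2.2
  have hd : frobSq (Mhat - E) ≤ 4 * frobSq (momentMatrix Ξ - E) := by
    linarith [frobSq_sub_le (momentMatrix Ξ) Mhat E, hproj E hE]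
  have hsqrt : √(κ * frobSq (Mhat - E)) ≤ 2 * √(κ * frobSq (momentMatrix Ξ - E)) := by
    rw [show (2 : ℝ) = √(2 ^ 2) by simp, ← Real.sqrt_mul (by norm_num)]
    refine Real.sqrt_le_sqrt ?_
    nlinarith
  have h1 := (abs_le.1 (abs_trace_mul_le R (Mhat - E) hR.2.2.2)).1
  have h2 := (abs_le.1 (abs_trace_mul_le R₀ (Mhat - E) h₀.2.2.2)).2
  rw [Matrix.mul_sub, Matrix.trace_sub] at h1 h2
  linarith [hopt θ₀ r₀ R₀ h₀]

end Deterministic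

/-! ### Decoupling the noise from the signals -/

section Stochastic

variable {Ω : Type*} [MeasurableSpace Ω] {μ : Measure Ω} [IsProbabilityMeasure μ]

/-- For independent `V` and `W`, events in `(V, W)` have vanishing probability as soon as they do so
for almost every frozen value of `W`. -/
theorem tendsto_measure_of_indepFun {X Y : Type*} [MeasurableSpace X] [MeasurableSpace Y]
    {V : Ω → X} {W : Ω → Y} (hV : Measurable V) (hW : Measurable W) (hVW : IndepFun V W μ)
    {S : ℕ → Set (X × Y)} (hS : ∀ T, MeasurableSet (S T))
    (h : ∀ᵐ ω ∂μ, Tendsto (fun T => μ {ω' | (V ω', W ω) ∈ S T}) atTop (𝓝 0)) :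
    Tendsto (fun T => μ {ω | (V ω, W ω) ∈ S T}) atTop (𝓝 0) := by
  have hVp : IsProbabilityMeasure (μ.map V) := Measure.isProbabilityMeasure_map hV.aemeasurable
  have hmeas : ∀ T, Measurable fun y => μ.map V {x | (x, y) ∈ S T} := fun T =>
    measurable_measure_prodMk_right (hS T)
  have hslice : ∀ T y, μ.map V {x | (x, y) ∈ S T} = μ {ω' | (V ω', y) ∈ S T} := fun T y =>
    Measure.map_apply hV (measurable_prodMk_right (hS T))
  have heq : ∀ T, μ {ω | (V ω, W ω) ∈ S T} = ∫⁻ ω, μ {ω' | (V ω', W ω) ∈ S T} ∂μ := by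
    intro T
    calc μ {ω | (V ω, W ω) ∈ S T} = μ.map (fun ω => (V ω, W ω)) (S T) :=
          (Measure.map_apply (hV.prodMk hW) (hS T)).symm
      _ = ∫⁻ y, μ.map V {x | (x, y) ∈ S T} ∂(μ.map W) := by
          rw [(indepFun_iff_map_prod_eq_prod_map_map hV.aemeasurable hW.aemeasurable).1 hVW,
            Measure.prod_apply_symm (hS T)]
          rfl
      _ = ∫⁻ ω, μ {ω' | (V ω', W ω) ∈ S T} ∂μ := by
          rw [lintegral_map (hmeas T) hW]
          simp only [hslice]
  simp only [heq]
  have := tendsto_lintegral_of_dominated_convergence (μ := μ) (f := fun _ => 0) (fun _ => 1)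
    (F := fun T ω => μ {ω' | (V ω', W ω) ∈ S T})
    (fun T => by
      simp only [← hslice]
      exact (hmeas T).comp hW)
    (fun T => ae_of_all _ fun ω => prob_le_one) (by simp) h
  simpa using this

/-! ### The data matrix and its limit -/

variable {nx nw N : ℕ}

/-- At fixed input and true states, the data matrix converges in probability to the moment matrix of
the experiment `i₀`. -/
theorem tendsto_measure_frobSq {v : Fin N → ℕ → Ω → Vec nx}
    (hvm : ∀ i t, Measurable (v i t)) {b : ℝ} (hvb : ∀ i t, ∀ᵐ ω ∂μ, ‖v i t ω‖ ≤ b)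
    (hv0 : ∀ i t, ∫ ω, v i t ω ∂μ = 0)
    (hvi : iIndepFun (fun (p : Fin N × ℕ) ω => v p.1 p.2 ω) μ)
    {w : ℕ → Vec nw} {x : Fin N → ℕ → Vec nx} {B : ℝ} (hw : ∀ t, ‖w t‖ ≤ B)
    (hx : ∀ i t, ‖x i t‖ ≤ B) (i₀ : Fin N)
    (hconv : ∀ i, Tendsto (fun t => x i t - x i₀ t) atTop (𝓝 0)) {η : ℝ} (hη : 0 < η) :
    Tendsto (fun T => μ {ω | η ≤ frobSq (momentMatrix
      (DataSet.restrict w (fun i t => x i t + v i t ω) T) - empMomentMatrix N w (x i₀) T)})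
      atTop (𝓝 0) := by
  set n : ℝ := (Fintype.card (aleph (nx + nx + nw) N) : ℝ)
  have hn : 0 ≤ n := Nat.cast_nonneg _
  set s : ℝ := √(η / (n * n + 1)) with hs_def
  have hs : 0 < s := Real.sqrt_pos.2 (by positivity)
  have hs2 : s ^ 2 * (n * n + 1) = η := by
    rw [hs_def, Real.sq_sqrt (by positivity)]
    field_simp
  have hdeg : ∀ α β : aleph (nx + nx + nw) N, ∑ d, (α.1 + β.1) d ≤ N := by
    intro α β
    have h1 := mem_aleph.1 α.2
    have h2 := mem_aleph.1 β.2
    simp only [Pi.add_apply, Finset.sum_add_distrib]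
    omega
  have hentry : ∀ α β : aleph (nx + nx + nw) N, Tendsto (fun T : ℕ => μ {ω | s ≤
      |linMoment (DataSet.restrict w (fun i t => x i t + v i t ω) T) (α.1 + β.1) -
        empMoment w (x i₀) T (α.1 + β.1)|}) atTop (𝓝 0) := by
    intro α β
    obtain ⟨c, hc⟩ := exists_measure_linMoment_le (μ := μ) hvm hvb hv0 hvi hw hx (α.1 + β.1)
    have hdet := (tendsto_linMoment_sub_empMoment hw hx i₀ hconv (hdeg α β)).abs
    rw [abs_zero] at hdet
    have hlim : Tendsto (fun T : ℕ => ENNReal.ofReal (c ^ 2 / T / (s / 2) ^ 2)) atTop (𝓝 0) := by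
      have h := ((tendsto_const_div_atTop_nhds_zero_nat (c ^ 2)).div_const ((s / 2) ^ 2))
      rw [zero_div] at h
      simpa using ENNReal.tendsto_ofReal h
    refine tendsto_of_tendsto_of_tendsto_of_le_of_le' tendsto_const_nhds hlim
      (Eventually.of_forall fun _ => zero_le) ?_
    filter_upwards [hdet.eventually_lt_const (half_pos hs)] with T hT
    refine (measure_mono fun ω hω => ?_).trans (hc T (s / 2) (half_pos hs))
    have hω' : s ≤ _ := hω
    have h3 := abs_sub_le (linMoment (DataSet.restrict w (fun i t => x i t + v i t ω) T)
      (α.1 + β.1)) (linMoment (DataSet.restrict w x T) (α.1 + β.1))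
      (empMoment w (x i₀) T (α.1 + β.1))
    simp only [Set.mem_ofPred_eq]
    linarith
  have hsum := tendsto_finsetSum (Finset.univ : Finset (aleph (nx + nx + nw) N)) fun α _ =>
    tendsto_finsetSum (Finset.univ : Finset (aleph (nx + nx + nw) N)) fun β _ => hentry α β
  simp only [Finset.sum_const_zero] at hsum
  refine tendsto_of_tendsto_of_tendsto_of_le_of_le tendsto_const_nhds hsum
    (fun _ => zero_le) fun T => ?_
  refine (measure_mono (fun ω hω => ?_)).trans
    ((measure_iUnion_fintype_le μ _).trans
      (Finset.sum_le_sum fun α _ => measure_iUnion_fintype_le μ _))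
  have hω' : η ≤ _ := hω
  by_contra hcon
  simp only [Set.mem_iUnion, Set.mem_ofPred_eq, not_exists, not_le] at hcon
  have hle : frobSq (momentMatrix (DataSet.restrict w (fun i t => x i t + v i t ω) T) -
      empMomentMatrix N w (x i₀) T) ≤ ∑ _α : aleph (nx + nx + nw) N,
        ∑ _β : aleph (nx + nx + nw) N, s ^ 2 := by
    refine Finset.sum_le_sum fun α _ => Finset.sum_le_sum fun β _ => ?_
    rw [← sq_abs]
    exact pow_le_pow_left₀ (abs_nonneg _) (hcon α β).le 2
  simp only [Finset.sum_const, Finset.card_univ, nsmul_eq_mul] at hle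
  nlinarith [sq_pos_of_pos hs]

theorem continuous_empMomentMatrix_apply (T : ℕ) (α β : aleph (nx + nx + nw) N) :
    Continuous fun u : (ℕ → Vec nw) × (ℕ → Vec nx) => empMomentMatrix N u.1 u.2 T α β := by
  simp only [empMomentMatrix, Matrix.of_apply, empMoment_eq_timeAverage, timeAverage]
  exact continuous_const.mul (continuous_finsetSum _ fun t _ =>
    (continuous_monom _).comp (continuous_trajectory_apply t))

theorem continuous_momentMatrix_apply (T : ℕ) (α β : aleph (nx + nx + nw) N) :
    Continuous fun u : (ℕ → Vec nw) × (Fin N → ℕ → Vec nx) =>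
      momentMatrix (DataSet.restrict u.1 u.2 T) α β := by
  simp only [momentMatrix, Matrix.of_apply, linMoment_restrict, timeAverage]
  refine continuous_const.mul (continuous_finsetSum _ fun t _ =>
    (continuous_pFun _).comp (continuous_pi fun i => ?_))
  exact (continuous_trajectory_apply t).comp
    (continuous_fst.prodMk ((continuous_apply i).comp continuous_snd))

/-- Openness holds for an arbitrary set `F`, as the condition is strict and continuous for each `R`. -/
theorem isOpen_setOf_exists_trace_lt
    (F : Set (Matrix (aleph (nx + nx + nw) N) (aleph (nx + nx + nw) N) ℝ)) (i₀ : Fin N)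
    (κ c : ℝ) (T : ℕ) :
    IsOpen {q : (Fin N × ℕ → Vec nx) × ((ℕ → Vec nw) × (Fin N × ℕ → Vec nx)) |
      ∃ R ∈ F, (R * empMomentMatrix N q.2.1 (fun t => q.2.2 (i₀, t)) T).trace <
        4 * √(κ * frobSq (momentMatrix (DataSet.restrict q.2.1
          (fun i t => q.2.2 (i, t) + q.1 (i, t)) T) -
            empMomentMatrix N q.2.1 (fun t => q.2.2 (i₀, t)) T)) + c} := by
  have hgE : Continuous
      fun q : (Fin N × ℕ → Vec nx) × ((ℕ → Vec nw) × (Fin N × ℕ → Vec nx)) =>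
        (q.2.1, fun t => q.2.2 (i₀, t)) := by fun_prop
  have hgM : Continuous
      fun q : (Fin N × ℕ → Vec nx) × ((ℕ → Vec nw) × (Fin N × ℕ → Vec nx)) =>
        (q.2.1, fun i t => q.2.2 (i, t) + q.1 (i, t)) := by fun_prop
  have hE := fun α β => (continuous_empMomentMatrix_apply (N := N) T α β).comp hgE
  have hM := fun α β => (continuous_momentMatrix_apply T α β).comp hgM
  simp only [← exists_prop, Set.ofPred_exists]
  refine isOpen_iUnion fun R => isOpen_iUnion fun _ => isOpen_lt ?_ ?_
  · simp only [Matrix.trace, Matrix.diag, Matrix.mul_apply]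
    exact continuous_finsetSum _ fun α _ => continuous_finsetSum _ fun β _ =>
      continuous_const.mul (hE β α)
  · refine (continuous_const.mul (Real.continuous_sqrt.comp (continuous_const.mul ?_))).add
      continuous_const
    simp only [frobSq, Matrix.sub_apply]
    exact continuous_finsetSum _ fun α _ => continuous_finsetSum _ fun β _ =>
      ((hM α β).sub (hE α β)).pow 2

theorem tendsto_response_sub {a : Vec nx × Vec nw → Vec nx} (ha : IsIncrExpStable a)
    (x₀ x₀' : Vec nx) (w : ℕ → Vec nw) :
    Tendsto (fun t => response a x₀ w t - response a x₀' w t) atTop (𝓝 0) := by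
  obtain ⟨c, ρ, -, hρ0, hρ1, h⟩ := ha
  refine squeeze_zero_norm (h x₀ x₀' w) ?_
  simpa using ((tendsto_pow_atTop_nhds_zero_of_lt_one hρ0.le hρ1).const_mul c).mul_const
    ‖x₀ - x₀'‖

end Stochastic

end SysId

/-! ### Consistency of the algorithm -/

open SysId
theorem theorem2 {Ω : Type*} [MeasurableSpace Ω] (μ : Measure Ω) [IsProbabilityMeasure μ]
    {nx nw ny nθ nPi N : ℕ} (hnx : 0 < nx) (hnw : 0 < nw) (hnθ : 0 < nθ) (hN : 0 < N)
    (φ : Fin nθ → Vec nx × Vec nw → Vec nx) (hφ : ∀ i, AnalyticOnNhd ℝ (φ i) Set.univ)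
    (ψ : Fin nθ → Vec nx → Vec nx) (hψ : ∀ i, AnalyticOnNhd ℝ (ψ i) Set.univ)
    (C : Matrix (Fin ny) (Fin nx) ℝ)
    (Pi : (Fin (nx + nx + nw + nx + nx) → ℝ) → Fin nPi → ℝ)
    (κ : ℝ) (hκ : 0 < κ) (δ : ℝ) (hδ : 0 < δ)
    (w : ℕ → Ω → Vec nw) (xbar v : Fin N → ℕ → Ω → Vec nx)
    (a₀ : Vec nx × Vec nw → Vec nx)
    (hA1 : BoundedInput μ w) (hA2 : NoiseConditions μ w xbar v) (hA4 : SystemConditions μ a₀ w xbar)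
    (ha₀ : a₀ ∈ recoverableSet φ ψ C N δ Pi κ)
    (θ : ℕ → Ω → Fin nθ → ℝ)
    (hθ : Tendsto (fun T : ℕ => μ {ω | ¬ IsAlgorithmOutput φ ψ C δ Pi κ
      (DataSet.restrict (fun t => w t ω) (fun i t => xbar i t ω + v i t ω) T) (θ T ω)})
      atTop (𝓝 0)) :
    ∀ K : Set (Vec nx × Vec nw), IsCompact K → ∀ ε : ℝ, 0 < ε →
      Tendsto (fun T : ℕ => μ {ω | ENNReal.ofReal ε ≤
        ⨆ p ∈ K, ENNReal.ofReal ‖implicitModel φ ψ (θ T ω) p - a₀ p‖}) atTop (𝓝 0) := by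
  intro K hK ε hε
  obtain ⟨hwm, b, hwb⟩ := hA1
  obtain ⟨hxm, hvm, ⟨bv, hvb⟩, hv0, -, hvi, hvw⟩ := hA2
  obtain ⟨hbibo, hstab, ⟨x₀, -, hresp⟩, hPE⟩ := hA4
  obtain ⟨θ₀, r₀, R₀, hfeas₀, hmodel, hr₀⟩ := ha₀
  have han : AnalyticOnNhd ℝ a₀ Set.univ := by
    rw [show a₀ = implicitModel φ ψ θ₀ from funext hmodel]
    exact hfeas₀.1.analyticOnNhd_implicitModel hδ hφ hψ
  set i₀ : Fin N := ⟨0, hN⟩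
  set F : Set (Matrix (aleph (nx + nx + nw) N) (aleph (nx + nx + nw) N) ℝ) :=
    {R | ∃ θ r, IsFeasible φ ψ C N δ Pi κ θ r R ∧
      ∃ p ∈ K, ε / 2 < ‖implicitModel φ ψ θ p - a₀ p‖} with hF
  set V : Ω → Fin N × ℕ → Vec nx := fun ω p => v p.1 p.2 ω with hVdef
  set W : Ω → (ℕ → Vec nw) × (Fin N × ℕ → Vec nx) := fun ω =>
    ((fun t => w t ω), fun p => xbar p.1 p.2 ω) with hWdef
  -- The parameter estimates need not be measurable. The bad event is therefore enlarged to an event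
  -- about the data alone, which the strict inequality makes open, whatever the set `F` is.
  set S : ℕ → Set ((Fin N × ℕ → Vec nx) × ((ℕ → Vec nw) × (Fin N × ℕ → Vec nx))) := fun T =>
    {q | ∃ R ∈ F, (R * empMomentMatrix N q.2.1 (fun t => q.2.2 (i₀, t)) T).trace <
      4 * √(κ * frobSq (momentMatrix (DataSet.restrict q.2.1
        (fun i t => q.2.2 (i, t) + q.1 (i, t)) T) -
          empMomentMatrix N q.2.1 (fun t => q.2.2 (i₀, t)) T)) + 1 / ((T : ℝ) + 1)} with hSdef
  have hSopen : ∀ T, IsOpen (S T) := fun T => isOpen_setOf_exists_trace_lt F i₀ κ _ T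
  have hVm : Measurable V := measurable_pi_lambda _ fun p => hvm p.1 p.2
  have hWm : Measurable W := (measurable_pi_lambda _ fun t => hwm t).prodMk
    (measurable_pi_lambda _ fun p => hxm p.1 p.2)
  have hbad : Tendsto (fun T => μ {ω | (V ω, W ω) ∈ S T}) atTop (𝓝 0) := by
    refine tendsto_measure_of_indepFun hVm hWm hvw (fun T => (hSopen T).measurableSet) ?_
    filter_upwards [ae_all_iff.2 hwb, hresp, hPE] with ω hwω hrω hPEω
    have hbd : ∃ B : ℝ, (∀ t, ‖w t ω‖ ≤ B) ∧ ∀ i t, ‖xbar i t ω‖ ≤ B := by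
      choose Bi hBi using fun i => hbibo (x₀ i ω) (fun t => w t ω) ⟨b, hwω⟩
      refine ⟨|b| + ∑ i, |Bi i|, fun t => ?_, fun i t => ?_⟩
      · have h1 : 0 ≤ ∑ i, |Bi i| := Finset.sum_nonneg fun _ _ => abs_nonneg _
        linarith [hwω t, le_abs_self b]
      · rw [hrω]
        have h1 := Finset.single_le_sum (f := fun i => |Bi i|) (fun _ _ => abs_nonneg _)
          (Finset.mem_univ i)
        linarith [hBi i t, le_abs_self (Bi i), abs_nonneg b]
    obtain ⟨B, hwB, hxB⟩ := hbd
    have hconv : ∀ i, Tendsto (fun t => xbar i t ω - xbar i₀ t ω) atTop (𝓝 0) := by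
      intro i
      simp only [hrω]
      exact tendsto_response_sub hstab _ _ _
    obtain ⟨η, hη, T₀, hthr⟩ := (hPEω i₀).exists_cost_threshold (φ := φ) (ψ := ψ) (C := C) (N := N)
      (κ := κ) (Pi := Pi) han hδ hψ hwB (hxB i₀) hK (half_pos hε)
    have hfrob := tendsto_measure_frobSq (μ := μ) hvm hvb hv0 hvi hwB hxB i₀ hconv
      (show 0 < η ^ 2 / (64 * κ) by positivity)
    refine tendsto_of_tendsto_of_tendsto_of_le_of_le' tendsto_const_nhds hfrob
      (Eventually.of_forall fun _ => zero_le) ?_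
    filter_upwards [eventually_ge_atTop T₀,
      (tendsto_one_div_add_atTop_nhds_zero_nat (𝕜 := ℝ)).eventually_lt_const (half_pos hη)]
      with T hT hTη
    refine measure_mono fun ω' hω' => ?_
    obtain ⟨R, ⟨θ', r, hfeas, p, hpK, hp⟩, hlt⟩ := hω'
    have h1 : η ≤ (R * empMomentMatrix N (fun t => w t ω) (fun t => xbar i₀ t ω) T).trace := by
      by_contra! hcon
      exact absurd (hthr T hT θ' r R hfeas hcon p hpK) (not_le.2 hp)
    have h2 := h1.trans_lt hlt
    set d := frobSq (momentMatrix (DataSet.restrict (fun t => w t ω)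
      (fun i t => xbar i t ω + v i t ω') T) -
        empMomentMatrix N (fun t => w t ω) (fun t => xbar i₀ t ω) T) with hd
    have h3 : η < 4 * √(κ * d) + 1 / ((T : ℝ) + 1) := h2
    have h4 : η / 8 ≤ √(κ * d) := by linarith
    have h5 := (Real.le_sqrt' (by positivity)).1 h4
    change η ^ 2 / (64 * κ) ≤ d
    rw [div_le_iff₀ (by positivity)]
    linarith
  have hsum := hθ.add hbad
  rw [add_zero] at hsum
  refine tendsto_of_tendsto_of_tendsto_of_le_of_le tendsto_const_nhds hsum
    (fun _ => zero_le) fun T => ?_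
  refine le_trans (measure_mono_ae ?_) (measure_union_le _ _)
  filter_upwards [hresp] with ω hrω hω
  by_cases hout : IsAlgorithmOutput φ ψ C δ Pi κ
      (DataSet.restrict (fun t => w t ω) (fun i t => xbar i t ω + v i t ω) T) (θ T ω)
  · right
    have htr : (R₀ * empMomentMatrix N (fun t => w t ω) (fun t => xbar i₀ t ω) T).trace = 0 := by
      rw [trace_mul_empMomentMatrix, timeAverage, Finset.sum_eq_zero, mul_zero]
      intro t _
      have h := hr₀ (xbar i₀ t ω, w (t + 1) ω)
      rw [hfeas₀.eval_gramPoly_eq, ← h, trajectory]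
      simp only [hrω i₀ (t + 1), hrω i₀ t, response]
    obtain ⟨r, R, hfeas, hle⟩ := hout.exists_trace_le hfeas₀
      (posSemidef_empMomentMatrix N (fun t => w t ω) (fun t => xbar i₀ t ω) T) htr
    refine ⟨R, ⟨θ T ω, r, hfeas, ?_⟩, hle.trans_lt (lt_add_of_pos_right _ (by positivity))⟩
    by_contra! hcon
    have h1 : ENNReal.ofReal ε ≤ ENNReal.ofReal (ε / 2) := le_trans hω
      (iSup₂_le fun p hp => ENNReal.ofReal_le_ofReal (hcon p hp))
    rw [ENNReal.ofReal_le_ofReal_iff (half_pos hε).le] at h1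
    linarith
  · left
    exact hout
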